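/- A multicast network is a finite directed multigraph \(D=(V,A)\), not necessarily acyclic, with a source \(s\in V\) and a nonempty set of receivers \(T\subseteq V\setminus\{s\}\), in which every arc has unit capacity. For \(t\in T\) let \(\lambda(t)\) be the maximum value of a flow from \(s\) to \(t\). A tree rooted at \(s\) is a set of arcs of \(D\) forming a directed tree all of whose arcs point away from \(s\). Routing achieves the rate \(k\in\mathbb{N}\) if there are \(k\) pairwise arc-disjoint trees rooted at \(s\), each of which reaches every receiver. A network code with \(m\ge 1\) messages, \(q\ge 2\) symbols and \(n\ge 1\) time slots lets every arc carry, in each slot, one of the \(q\) symbols, depending on the message that the source multicasts, in such a way that what a node other than \(s\) sends in a slot is a function of what it received in earlier slots, and each receiver can recover the message from what it received in all \(n\) slots. Its rate is \(\log m/(n\log q)\). The network-coding capacity of \(D\) is the supremum of the rates of all network codes. **Theorem.** Suppose that the underlying undirected simple graph of \(D\), obtained by ignoring orientations and merging parallel arcs, has no \(K_4\) minor. Then \(h=\min_{t\in T}\lambda(t)\) is an integer, it is the network-coding capacity of \(D\), and it is the largest rate that routing achieves. In particular there are \(h\) pairwise arc-disjoint trees rooted at \(s\), each reaching every receiver, so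 that network coding is unnecessary to achieve the maximum throughput. -/

import Mathlib

/-- The undirected simple graph `M` is a minor of `G`: there are pairwise disjoint, nonempty,
connected branch sets in `G`, one for each vertex of `M`, such that adjacent vertices of `M` have
branch sets joined by an edge of `G`. -/
def SimpleGraph.HasMinor {V W : Type*} (G : SimpleGraph V) (M : SimpleGraph W) : Prop :=
  ∃ B : W → Set V,
    (∀ w, (G.induce (B w)).Connected) ∧
    (Pairwise fun w w' => Disjoint (B w) (B w')) ∧
    ∀ w w', M.Adj w w' → ∃ x ∈ B w, ∃ y ∈ B w', G.Adj x y

/-- A multicast network: a directed multigraph with vertex type `V` and arc type `A` (every arc has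
unit capacity; parallel arcs, directed cycles and loops are allowed), a source, and a nonempty set
of receivers that does not contain the source. -/
structure MulticastNetwork (V A : Type*) where
  /-- the node at which an arc starts -/
  tail : A → V
  /-- the node at which an arc ends -/
  head : A → V
  source : V
  receivers : Finset V
  receivers_nonempty : receivers.Nonempty
  source_notMem : source ∉ receivers

namespace MulticastNetwork

variable {V A : Type*}

/-- The underlying simple graph: orientations are ignored, parallel links are merged. -/
def topology (D : MulticastNetwork V A) : SimpleGraph V :=
  SimpleGraph.fromRel fun u v => ∃ e, D.tail e = u ∧ D.head e = v

section Flow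

variable [Fintype A]

open scoped Classical in
/-- The amount of `f` entering the node `v` minus the amount leaving it. -/
noncomputable def netInflow (D : MulticastNetwork V A) (f : A → ℝ) (v : V) : ℝ :=
  (∑ e with D.head e = v, f e) - ∑ e with D.tail e = v, f e

/-- `f` is a flow from the source to the node `t` respecting the unit capacities. -/
def IsFlowTo (D : MulticastNetwork V A) (t : V) (f : A → ℝ) : Prop :=
  (∀ e, 0 ≤ f e ∧ f e ≤ 1) ∧ ∀ v, v ≠ D.source → v ≠ t → D.netInflow f v = 0

/-- The values of the flows from the source to `t`. -/
def flowValues (D : MulticastNetwork V A) (t : V) : Set ℝ :=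
  {r | ∃ f, D.IsFlowTo t f ∧ D.netInflow f t = r}

theorem flowValues_nonempty (D : MulticastNetwork V A) (t : V) : (D.flowValues t).Nonempty :=
  ⟨0, fun _ => 0, ⟨fun _ => ⟨le_rfl, zero_le_one⟩, fun v _ _ => by simp [netInflow]⟩,
    by simp [netInflow]⟩

theorem flowValues_bddAbove (D : MulticastNetwork V A) (t : V) : BddAbove (D.flowValues t) := by
  classical
  refine ⟨Fintype.card A, ?_⟩
  rintro r ⟨f, ⟨hf, -⟩, rfl⟩
  have h1 : 0 ≤ ∑ e with D.tail e = t, f e := Finset.sum_nonneg fun e _ => (hf e).1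
  have h2 : ∑ e with D.head e = t, f e ≤ ∑ e, f e :=
    Finset.sum_le_sum_of_subset_of_nonneg (Finset.filter_subset _ _) fun e _ _ => (hf e).1
  have h3 : ∑ e, f e ≤ ∑ _e : A, (1 : ℝ) := Finset.sum_le_sum fun e _ => (hf e).2
  simp only [Finset.sum_const, Finset.card_univ, nsmul_eq_mul, mul_one] at h3
  unfold netInflow
  convert (sub_le_self _ h1).trans (h2.trans h3)

/-- `λ(t)`: the maximum value of a flow from the source to the node `t` (for `t ≠ source`). -/
noncomputable def maxFlow (D : MulticastNetwork V A) (t : V) : ℝ :=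
  sSup (D.flowValues t)

/-- The minimum of `λ(t)` over all receivers `t`. -/
noncomputable def minMaxFlow (D : MulticastNetwork V A) : ℝ :=
  D.receivers.inf' D.receivers_nonempty D.maxFlow

end Flow

/-! ### Routing -/

/-- `v` can be reached from the source by a directed path with all its arcs in `F`. -/
def Reaches (D : MulticastNetwork V A) (F : Set A) (v : V) : Prop :=
  Relation.ReflTransGen (fun u w => ∃ e ∈ F, D.tail e = u ∧ D.head e = w) D.source v

/-- The arc set `F` forms a directed tree rooted at the source, its arcs pointing away from it: no
arc of `F` enters the source, at most one arc of `F` enters each node, and every arc of `F` starts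
at a node reached from the source within `F`. -/
def IsTree (D : MulticastNetwork V A) (F : Set A) : Prop :=
  (∀ e ∈ F, D.head e ≠ D.source) ∧
  (∀ e ∈ F, ∀ e' ∈ F, D.head e = D.head e' → e = e') ∧
  ∀ e ∈ F, D.Reaches F (D.tail e)

/-- There are `k` pairwise arc-disjoint trees rooted at the source, each reaching every receiver:
routing achieves the multicast rate `k`. -/
def HasTreePacking (D : MulticastNetwork V A) (k : ℕ) : Prop :=
  ∃ F : Fin k → Set A,
    (Pairwise fun i j => Disjoint (F i) (F j)) ∧
    ∀ i, D.IsTree (F i) ∧ ∀ t ∈ D.receivers, D.Reaches (F i) t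

/-! ### Network coding -/

/-- A network code with `m` messages, an alphabet of `q` symbols, and `n` time slots. In each slot
each arc carries one symbol. Local coding functions are expressed by determination: what a node
other than the source sends in a slot is a function of what it received in earlier slots, and each
receiver can recover the message from what it received in all slots. -/
structure NetworkCode (D : MulticastNetwork V A) (m q n : ℕ) where
  /-- `symbol x e i` is what arc `e` carries in slot `i` when the source multicasts `x`. -/
  symbol : Fin m → A → Fin n → Fin q
  causal : ∀ e, D.tail e ≠ D.source → ∀ i x y,
    (∀ e', D.head e' = D.tail e → ∀ j < i, symbol x e' j = symbol y e' j) →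
      symbol x e i = symbol y e i
  decodable : ∀ t ∈ D.receivers, ∀ x y,
    (∀ e, D.head e = t → ∀ j, symbol x e j = symbol y e j) → x = y

/-- The multicast rates achieved by network codes, in symbols per time slot. -/
def codingRates (D : MulticastNetwork V A) : Set ℝ :=
  {r | ∃ m q n : ℕ, 1 ≤ m ∧ 2 ≤ q ∧ 1 ≤ n ∧ Nonempty (D.NetworkCode m q n) ∧
    r = Real.log m / (n * Real.log q)}

end MulticastNetwork

/-! Everything is compared with the least number `h` of arcs entering a vertex set that contains a
receiver but not the source. Such a cut bounds flow values, tree packings and coding rates alike, so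
it suffices to pack `h` arc-disjoint trees: each tree carries a unit of flow to every receiver and,
with bounded delay, a stream of symbols. All the bounds are then attained, and max-flow min-cut is
not needed.

The packing is `exists_treePacking`, strengthened for induction: one family of `k` trees serves all
vertices and all adjacent pairs simultaneously, each as often as the cuts, capped at `k`, allow. The
induction removes a vertex `v ≠ s` whose neighbours are among `a`, `b`, and replaces the paths `a →
v → b` and `b → v → a` by arcs whose capacity is the smaller of the two along the path. Cuts around
the remaining vertices keep their bounds (`IsCutBound.reduction`). Conversely, `exists_insertVertex`
reroutes trees on the new arcs through `v` and hangs `v` as a leaf on further trees while capacity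
lasts. The number of trees meeting `{a, b}` decides how often `v` can be served, which is why
adjacent pairs belong in the induction.

The vertex `v` comes from `exists_isLowDegree`. In a minimal counterexample, contracting an edge
shows that it lies in a triangle with a cubic apex; using this twice yields adjacent twins. These
give a `K₄` minor, or a smaller piece whose low-degree vertex has low degree in the whole graph. -/

namespace SimpleGraph

/-! ### Minors, contraction and connected sets -/

variable {V W : Type*}

/-- A set of vertices is connected iff every property that holds at one of its vertices and
spreads along its edges holds on all of it. -/
theorem induce_connected_iff (G : SimpleGraph V) (S : Set V) :
    (G.induce S).Connected ↔ S.Nonempty ∧ ∀ x ∈ S, ∀ P : V → Prop, P x →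
      (∀ u ∈ S, ∀ w ∈ S, G.Adj u w → P u → P w) → ∀ y ∈ S, P y := by
  constructor
  · intro h
    refine ⟨Set.nonempty_coe_sort.1 h.nonempty, fun x hx P hP hstep y hy => ?_⟩
    have hr := h.preconnected ⟨x, hx⟩ ⟨y, hy⟩
    rw [reachable_iff_reflTransGen] at hr
    have : ∀ z : S, Relation.ReflTransGen (G.induce S).Adj ⟨x, hx⟩ z → P z := by
      intro z hz
      induction hz with
      | refl => exact hP
      | tail _ hadj ih => exact hstep _ (Subtype.coe_prop _) _ (Subtype.coe_prop _) hadj ih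
    exact this _ hr
  · rintro ⟨hne, h⟩
    rw [connected_iff]
    refine ⟨fun x y => ?_, Set.nonempty_coe_sort.2 hne⟩
    obtain ⟨hy, hr⟩ := h x x.2 (fun z => ∃ hz : z ∈ S, (G.induce S).Reachable x ⟨z, hz⟩)
      ⟨x.2, Reachable.refl _⟩
      (fun u hu w hw hadj ⟨_, hr⟩ => ⟨hw, hr.trans (Adj.reachable (by exact hadj))⟩) y y.2
    exact hr

theorem HasMinor.mono {G H : SimpleGraph V} {M : SimpleGraph W} (hle : H ≤ G)
    (h : H.HasMinor M) : G.HasMinor M := by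
  obtain ⟨B, hc, hd, ha⟩ := h
  refine ⟨B, fun w => (hc w).mono fun _ _ hadj => hle hadj, hd, fun w w' hww => ?_⟩
  obtain ⟨x, hx, y, hy, hxy⟩ := ha w w' hww
  exact ⟨x, hx, y, hy, hle hxy⟩

/-- Contraction of the edge `av` into `a`, on the same vertex type: `v` becomes isolated. -/
def contractInto (G : SimpleGraph V) (a v : V) : SimpleGraph V where
  Adj u w := u ≠ v ∧ w ≠ v ∧ u ≠ w ∧ (G.Adj u w ∨ (u = a ∧ G.Adj v w) ∨ (w = a ∧ G.Adj v u))
  symm := ⟨fun u w h => ⟨h.2.1, h.1, h.2.2.1.symm, by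
    rcases h.2.2.2 with h | h | h
    · exact Or.inl h.symm
    · exact Or.inr (Or.inr h)
    · exact Or.inr (Or.inl h)⟩⟩
  loopless := ⟨fun u h => h.2.2.1 rfl⟩

theorem contractInto_adj {G : SimpleGraph V} {a v u w : V} : (G.contractInto a v).Adj u w ↔
    u ≠ v ∧ w ≠ v ∧ u ≠ w ∧ (G.Adj u w ∨ (u = a ∧ G.Adj v w) ∨ (w = a ∧ G.Adj v u)) := Iff.rfl

theorem support_contractInto_ssubset {G : SimpleGraph V} {a v : V} (h : G.Adj v a) :
    (G.contractInto a v).support ⊂ G.support := by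
  refine ⟨?_, fun hss => ?_⟩
  · rintro u ⟨w, -, -, -, huw | ⟨rfl, -⟩ | ⟨-, hvu⟩⟩
    · exact ⟨w, huw⟩
    · exact ⟨v, h.symm⟩
    · exact ⟨v, hvu.symm⟩
  · obtain ⟨w, hw, -⟩ := hss ⟨a, h⟩
    exact hw rfl

open scoped Classical in
-- An edge created by the contraction starts at `a` and is replaced by a detour through `v`; it
-- matters only if `a ∈ S`, and then `v` joins the set.
theorem induce_connected_of_contractInto {G : SimpleGraph V} {a v : V} (h : G.Adj v a) {S : Set V}
    (hS : ((G.contractInto a v).induce S).Connected) (hv : v ∉ S) :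
    (G.induce (if a ∈ S then insert v S else S)).Connected := by
  rw [induce_connected_iff] at hS ⊢
  obtain ⟨hne, hS⟩ := hS
  by_cases ha : a ∈ S
  · simp only [ha, if_true]
    refine ⟨⟨v, Set.mem_insert _ _⟩, fun x hx P hPx hstep => ?_⟩
    have hva : P v → P a := hstep v (Set.mem_insert _ _) a (Set.mem_insert_of_mem _ ha) h
    have hav : P a → P v := hstep a (Set.mem_insert_of_mem _ ha) v (Set.mem_insert _ _) h.symm
    have hall : ∀ x ∈ S, P x → ∀ y ∈ S, P y := by
      refine fun x hx hPx => hS x hx P hPx fun u hu w hw huw hPu => ?_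
      obtain ⟨-, -, -, hadj | ⟨rfl, hadj⟩ | ⟨rfl, hadj⟩⟩ := huw
      · exact hstep u (Set.mem_insert_of_mem _ hu) w (Set.mem_insert_of_mem _ hw) hadj hPu
      · exact hstep v (Set.mem_insert _ _) w (Set.mem_insert_of_mem _ hw) hadj (hav hPu)
      · exact hva (hstep u (Set.mem_insert_of_mem _ hu) v (Set.mem_insert _ _) hadj.symm hPu)
    have hPa : P a := by
      rcases Set.mem_insert_iff.1 hx with rfl | hx
      · exact hva hPx
      · exact hall x hx hPx a ha
    intro y hy
    rcases Set.mem_insert_iff.1 hy with rfl | hy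
    · exact hav hPa
    · exact hall a ha hPa y hy
  · simp only [ha, if_false]
    refine ⟨hne, fun x hx P hPx hstep => hS x hx P hPx fun u hu w hw huw hPu => ?_⟩
    obtain ⟨-, -, -, hadj | ⟨rfl, hadj⟩ | ⟨rfl, hadj⟩⟩ := huw
    · exact hstep u hu w hw hadj hPu
    · exact absurd hu ha
    · exact absurd hw ha

/-- A complete minor with at least two branch sets survives undoing a contraction. -/
theorem HasMinor.of_contractInto [Nontrivial W] {G : SimpleGraph V} {a v : V} (h : G.Adj v a)
    (hM : (G.contractInto a v).HasMinor (⊤ : SimpleGraph W)) :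
    G.HasMinor (⊤ : SimpleGraph W) := by
  classical
  obtain ⟨B, hc, hd, hadj⟩ := hM
  -- As `v` is isolated after the contraction, its branch set would be `{v}`, with no edge to a
  -- second branch set.
  have hv : ∀ w, v ∉ B w := by
    intro w hvw
    have hc' := (induce_connected_iff _ _).1 (hc w)
    have hall : ∀ y ∈ B w, y = v := hc'.2 v hvw (· = v) rfl
      fun u _ z _ huz hu => absurd hu huz.1
    obtain ⟨w', hw'⟩ := exists_ne w
    obtain ⟨x, hx, y, -, hxy⟩ := hadj w w' hw'.symm
    exact hxy.1 (hall x hx)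
  have hsub : ∀ w, B w ⊆ (if a ∈ B w then insert v (B w) else B w) := by
    intro w
    split_ifs
    · exact Set.subset_insert _ _
    · exact subset_rfl
  have hmem : ∀ w, a ∈ B w → v ∈ (if a ∈ B w then insert v (B w) else B w) := by
    intro w hw
    simp [hw]
  refine ⟨fun w => if a ∈ B w then insert v (B w) else B w,
    fun w => induce_connected_of_contractInto h (hc w) (hv w), fun w w' hww => ?_,
    fun w w' hww => ?_⟩
  · have hdis := Set.disjoint_left.1 (hd hww)
    refine Set.disjoint_left.2 fun x hx hx' => ?_
    dsimp only at hx hx'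
    have hvw := hv w
    have hvw' := hv w'
    split_ifs at hx hx' with h1 h2 h2
    · exact hdis h1 h2
    · rcases Set.mem_insert_iff.1 hx with rfl | hx
      · exact hvw' hx'
      · exact hdis hx hx'
    · rcases Set.mem_insert_iff.1 hx' with rfl | hx'
      · exact hvw hx
      · exact hdis hx hx'
    · exact hdis hx hx'
  · obtain ⟨x, hx, y, hy, -, -, -, hxy | ⟨rfl, hxy⟩ | ⟨rfl, hxy⟩⟩ := hadj w w' hww
    · exact ⟨x, hsub w hx, y, hsub w' hy, hxy⟩
    · exact ⟨v, hmem w hx, y, hsub w' hy, hxy⟩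
    · exact ⟨x, hsub w hx, v, hmem w' hy, hxy.symm⟩

/-- Two adjacent vertices with common neighbours `a`, `b` joined by a path avoiding both
vertices give a `K₄` minor. -/
theorem hasMinor_four_of_twins {G : SimpleGraph V} {x y a b u : V} {C : Set V} (hxy : G.Adj x y)
    (hxa : G.Adj x a) (hxb : G.Adj x b) (hya : G.Adj y a) (hyb : G.Adj y b)
    (hC : (G.induce C).Connected) (haC : a ∈ C) (huC : u ∈ C) (hub : G.Adj u b)
    (hxC : x ∉ C) (hyC : y ∉ C) (hbC : b ∉ C) : G.HasMinor (⊤ : SimpleGraph (Fin 4)) := by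
  have hs : ∀ z : V, (G.induce {z}).Connected := fun z => by
    rw [induce_connected_iff]
    exact ⟨Set.singleton_nonempty z, by rintro _ rfl P hP _ _ rfl; exact hP⟩
  have := hxy.ne
  have := hxb.ne
  have := hyb.ne
  refine ⟨![{x}, {y}, {b}, C], ?_, ?_, ?_⟩
  · intro w
    fin_cases w
    exacts [hs x, hs y, hs b, hC]
  · intro w w' hww
    fin_cases w <;> fin_cases w' <;> simp_all [Ne.symm]
  · have key : ∀ w w' : Fin 4, w < w' → ∃ p ∈ (![{x}, {y}, {b}, C] : Fin 4 → Set V) w,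
        ∃ q ∈ (![{x}, {y}, {b}, C] : Fin 4 → Set V) w', G.Adj p q := by
      intro w w' hww
      fin_cases w <;> fin_cases w' <;> first
        | exact absurd hww (by decide)
        | exact ⟨x, rfl, y, rfl, hxy⟩
        | exact ⟨x, rfl, b, rfl, hxb⟩
        | exact ⟨x, rfl, a, haC, hxa⟩
        | exact ⟨y, rfl, b, rfl, hyb⟩
        | exact ⟨y, rfl, a, haC, hya⟩
        | exact ⟨b, rfl, u, huC, hub.symm⟩
    intro w w' hww
    rcases lt_or_gt_of_ne hww.ne with hlt | hlt
    · exact key w w' hlt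
    · obtain ⟨p, hp, q, hq, hpq⟩ := key w' w hlt
      exact ⟨q, hq, p, hp, hpq.symm⟩

/-- The set of vertices reached from `a` by paths avoiding `X`. -/
def reachAvoiding (G : SimpleGraph V) (X : Set V) (a : V) : Set V :=
  {u | Relation.ReflTransGen (fun p q => G.Adj p q ∧ q ∉ X) a u}

section reachAvoiding

variable {G : SimpleGraph V} {X : Set V} {a u w : V}

theorem mem_reachAvoiding_self : a ∈ G.reachAvoiding X a := Relation.ReflTransGen.refl

theorem mem_reachAvoiding_of_adj (hu : u ∈ G.reachAvoiding X a) (h : G.Adj u w) (hw : w ∉ X) :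
    w ∈ G.reachAvoiding X a := Relation.ReflTransGen.tail hu ⟨h, hw⟩

theorem reachAvoiding_induction {P : V → Prop} (ha : P a)
    (hstep : ∀ p q, p ∈ G.reachAvoiding X a → G.Adj p q → q ∉ X → P p → P q) :
    ∀ u ∈ G.reachAvoiding X a, P u := by
  intro u hu
  induction hu with
  | refl => exact ha
  | tail h hpq ih => exact hstep _ _ h hpq.1 hpq.2 ih

theorem notMem_of_mem_reachAvoiding (ha : a ∉ X) (hu : u ∈ G.reachAvoiding X a) : u ∉ X :=
  reachAvoiding_induction (P := (· ∉ X)) ha (fun _ _ _ _ hq _ => hq) u hu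

theorem induce_reachAvoiding_connected :
    (G.induce (G.reachAvoiding X a)).Connected := by
  rw [induce_connected_iff]
  refine ⟨⟨a, mem_reachAvoiding_self⟩, fun x hx P hPx hstep => ?_⟩
  have hPa : P a := by
    refine reachAvoiding_induction (P := fun z => P z → P a) id ?_ x hx hPx
    intro p q hp hpq hq ih hPq
    exact ih (hstep q (mem_reachAvoiding_of_adj hp hpq hq) p hp hpq.symm hPq)
  exact reachAvoiding_induction hPa fun p q hp hpq hq =>
    hstep p hp q (mem_reachAvoiding_of_adj hp hpq hq) hpq

end reachAvoiding

/-! ### Low-degree vertices in graphs without `K₄` minor -/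

/-- `v` is not isolated and has at most two neighbours. -/
def IsLowDegree (G : SimpleGraph V) (v : V) : Prop :=
  ∃ a b, G.Adj v a ∧ ∀ w, G.Adj v w → w = a ∨ w = b

theorem exists_third_adj {G : SimpleGraph V} {v u : V} (h : ¬ G.IsLowDegree v) (hvu : G.Adj v u)
    (a b : V) : ∃ w, G.Adj v w ∧ w ≠ a ∧ w ≠ b := by
  by_contra! hcon
  have hab : ∀ w, G.Adj v w → w = a ∨ w = b := fun w hw => or_iff_not_imp_left.2 (hcon w hw)
  rcases hab u hvu with rfl | rfl
  · exact h ⟨u, b, hvu, hab⟩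
  · exact h ⟨u, a, hvu, fun w hw => (hab w hw).symm⟩

/-- In a minimal graph without low-degree vertices other than `s`, no component avoiding `s` hangs
off a vertex `a` next to two adjacent twins `x`, `y`. -/
theorem not_twins_of_component {G : SimpleGraph V} {s x y a b : V}
    (hlow : ∀ v, v ≠ s → ¬ G.IsLowDegree v)
    (IH : ∀ (H : SimpleGraph V) (r : V), H ≤ G → H.support ⊂ G.support → (∃ u w, H.Adj u w) →
      ∃ v, v ≠ r ∧ H.IsLowDegree v)
    (hxy : G.Adj x y) (hxa : G.Adj x a) (hya : G.Adj y a)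
    (hNx : ∀ w, G.Adj x w → w = y ∨ w = a ∨ w = b)
    (hNy : ∀ w, G.Adj y w → w = x ∨ w = a ∨ w = b) (hab : a ≠ b)
    (hs : s ∉ G.reachAvoiding {x, y, b} a)
    (hb : ∀ u ∈ G.reachAvoiding {x, y, b} a, ¬ G.Adj u b) : False := by
  set C := G.reachAvoiding {x, y, b} a with hC
  have haX : a ∉ ({x, y, b} : Set V) := by
    simp [hxa.ne', hya.ne', hab]
  have hCX : ∀ u ∈ C, u ≠ x ∧ u ≠ y ∧ u ≠ b := fun u hu => by
    simpa using notMem_of_mem_reachAvoiding haX hu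
  have haC : a ∈ C := mem_reachAvoiding_self
  have hstep : ∀ u ∈ C, ∀ w, G.Adj u w → w ≠ x → w ≠ y → w ∈ C := fun u hu w huw hwx hwy => by
    refine mem_reachAvoiding_of_adj hu huw ?_
    have : w ≠ b := by rintro rfl; exact hb u hu huw
    simp [*]
  -- Only `a` can have neighbours outside `C`. Prescribing `a` as the excluded vertex of `H`
  -- therefore yields a vertex whose degrees in `H` and in `G` agree.
  let H : SimpleGraph V :=
    { Adj := fun u w => G.Adj u w ∧ u ∈ C ∧ w ∈ C
      symm := ⟨fun u w h => ⟨h.1.symm, h.2.2, h.2.1⟩⟩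
      loopless := ⟨fun u h => h.1.ne rfl⟩ }
  obtain ⟨w, haw, hwx, hwy⟩ :=
    exists_third_adj (hlow a (by rintro rfl; exact hs haC)) hxa.symm x y
  obtain ⟨v, hva, p, q, hvp, hvpq⟩ := IH H a (fun u w h => h.1)
    ⟨fun u ⟨w, h⟩ => ⟨w, h.1⟩, fun hss => by
      obtain ⟨w, -, h, -⟩ := hss ⟨y, hxy⟩
      exact (hCX x h).1 rfl⟩
    ⟨a, w, haw, haC, hstep a haC w haw hwx hwy⟩
  have hvC : v ∈ C := hvp.2.1
  refine hlow v (by rintro rfl; exact hs hvC) ⟨p, q, hvp.1, fun w hvw => hvpq w ⟨hvw, hvC, ?_⟩⟩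
  refine hstep v hvC w hvw ?_ ?_
  · rintro rfl
    rcases hNx v hvw.symm with h | h | h
    exacts [(hCX v hvC).2.1 h, hva h, (hCX v hvC).2.2 h]
  · rintro rfl
    rcases hNy v hvw.symm with h | h | h
    exacts [(hCX v hvC).1 h, hva h, (hCX v hvC).2.2 h]

/-- In a minimal `K₄`-minor-free graph without low-degree vertices other than `s`, no two adjacent
vertices share their at most two further neighbours. -/
theorem not_twins {G : SimpleGraph V} {s x y a b : V}
    (hK : ¬ G.HasMinor (⊤ : SimpleGraph (Fin 4)))
    (hlow : ∀ v, v ≠ s → ¬ G.IsLowDegree v)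
    (IH : ∀ (H : SimpleGraph V) (r : V), H ≤ G → H.support ⊂ G.support → (∃ u w, H.Adj u w) →
      ∃ v, v ≠ r ∧ H.IsLowDegree v)
    (hxs : x ≠ s) (hys : y ≠ s) (hxy : G.Adj x y)
    (hNx : ∀ w, G.Adj x w → w = y ∨ w = a ∨ w = b)
    (hNy : ∀ w, G.Adj y w → w = x ∨ w = a ∨ w = b) : False := by
  have third : ∀ x y a b, G.Adj x y → x ≠ s → (∀ w, G.Adj x w → w = y ∨ w = a ∨ w = b) →
      G.Adj x b ∧ b ≠ a := by
    intro x y a b hxy hxs hN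
    obtain ⟨w, hw, hwy, hwa⟩ := exists_third_adj (hlow x hxs) hxy y a
    rcases hN w hw with h | h | rfl
    exacts [absurd h hwy, absurd h hwa, ⟨hw, hwa⟩]
  obtain ⟨hxb, hba⟩ := third x y a b hxy hxs hNx
  obtain ⟨hyb, -⟩ := third y x a b hxy.symm hys hNy
  obtain ⟨hxa, -⟩ := third x y b a hxy hxs fun w hw => (hNx w hw).imp_right Or.symm
  obtain ⟨hya, -⟩ := third y x b a hxy.symm hys fun w hw => (hNy w hw).imp_right Or.symm
  -- Otherwise `x`, `y`, `b` and the component of `a` are the branch sets of a `K₄` minor.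
  have noadj : ∀ a b, G.Adj x a → G.Adj x b → G.Adj y a → G.Adj y b → a ≠ b →
      ∀ u ∈ G.reachAvoiding {x, y, b} a, ¬ G.Adj u b := by
    intro a b hxa hxb hya hyb hab u hu hub
    have haX : a ∉ ({x, y, b} : Set V) := by
      simp [hxa.ne', hya.ne', hab]
    have hX : ∀ z ∈ ({x, y, b} : Set V), z ∉ G.reachAvoiding {x, y, b} a :=
      fun z hz hz' => notMem_of_mem_reachAvoiding haX hz' hz
    exact hK (hasMinor_four_of_twins hxy hxa hxb hya hyb induce_reachAvoiding_connected
      mem_reachAvoiding_self hu hub (hX x (by simp)) (hX y (by simp)) (hX b (by simp)))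
  have h1 := noadj a b hxa hxb hya hyb hba.symm
  have h2 := noadj b a hxb hxa hyb hya hba
  -- The components of `a` and of `b` are disjoint, so one of them misses `s`.
  by_cases hs1 : s ∈ G.reachAvoiding {x, y, b} a
  · refine not_twins_of_component hlow IH hxy hxb hyb
      (fun w hw => (hNx w hw).imp_right Or.symm) (fun w hw => (hNy w hw).imp_right Or.symm) hba
      (fun hs2 => ?_) h2
    have haX : a ∉ ({x, y, b} : Set V) := by
      simp [hxa.ne', hya.ne', hba.symm]
    refine reachAvoiding_induction (P := fun z => z ∉ G.reachAvoiding {x, y, b} a)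
      (fun h => notMem_of_mem_reachAvoiding haX h (by simp)) ?_ s hs2 hs1
    intro p q hp hpq hq ih hq1
    refine ih (mem_reachAvoiding_of_adj hq1 hpq.symm ?_)
    have hbX : b ∉ ({x, y, a} : Set V) := by
      simp [hxb.ne', hyb.ne', hba]
    have hpX := notMem_of_mem_reachAvoiding hbX hp
    have hpb : p ≠ b := by
      rintro rfl
      exact h1 q hq1 hpq.symm
    simp only [Set.mem_insert_iff, Set.mem_singleton_iff, not_or] at hpX ⊢
    exact ⟨hpX.1, hpX.2.1, hpb⟩
  · exact not_twins_of_component hlow IH hxy hxa hya hNx hNy hba.symm hs1 h1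

/-- In such a graph, every edge lies in a triangle whose third vertex has degree three. -/
theorem exists_cubic_of_adj {G : SimpleGraph V} {s x y : V}
    (hK : ¬ G.HasMinor (⊤ : SimpleGraph (Fin 4)))
    (hlow : ∀ v, v ≠ s → ¬ G.IsLowDegree v)
    (IH : ∀ (H : SimpleGraph V) (r : V), ¬ H.HasMinor (⊤ : SimpleGraph (Fin 4)) →
      H.support ⊂ G.support → (∃ u w, H.Adj u w) → ∃ v, v ≠ r ∧ H.IsLowDegree v)
    (hxy : G.Adj x y) (hys : y ≠ s) :
    ∃ z w, z ≠ s ∧ G.Adj z x ∧ G.Adj z y ∧ G.Adj z w ∧ w ≠ x ∧ w ≠ y ∧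
      ∀ u, G.Adj z u → u = x ∨ u = y ∨ u = w := by
  obtain ⟨w, hyw, hwx, -⟩ := exists_third_adj (hlow y hys) hxy.symm x x
  obtain ⟨z, hzs, a, b, hza, hzab⟩ := IH (G.contractInto x y) s
    (fun h => hK (h.of_contractInto hxy.symm)) (support_contractInto_ssubset hxy.symm)
    ⟨x, w, hxy.ne, hyw.ne', hwx.symm, Or.inr (Or.inl ⟨rfl, hyw⟩)⟩
  simp only [contractInto_adj] at hza hzab
  have hzy : z ≠ y := hza.1
  -- If the low-degree vertex is the merged one, `x` and `y` together have at most two further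
  -- neighbours and are twins.
  by_cases hzx : z = x
  · subst hzx
    refine (not_twins (a := a) (b := b) hK hlow
      (fun H r hle => IH H r fun h => hK (h.mono hle)) hzs hys hxy ?_ ?_).elim
    · intro w hw
      by_cases hwy : w = y
      · exact Or.inl hwy
      · exact Or.inr (hzab w ⟨hzy, hwy, hw.ne, Or.inl hw⟩)
    · intro w hw
      by_cases hwz : w = z
      · exact Or.inl hwz
      · exact Or.inr (hzab w ⟨hzy, hw.ne', Ne.symm hwz, Or.inr (Or.inl ⟨rfl, hw⟩)⟩)
  have hNz : ∀ u, G.Adj z u → u ≠ y → u = a ∨ u = b := fun u hzu huy =>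
    hzab u ⟨hzy, huy, hzu.ne, Or.inl hzu⟩
  obtain ⟨z', hz'⟩ : ∃ u, G.Adj z u := by
    rcases hza.2.2.2 with h | h | h
    exacts [⟨a, h⟩, absurd h.1 hzx, ⟨y, h.2.symm⟩]
  -- The contraction lowers the degree of `z ≠ x` only by merging neighbours `x` and `y`. Having
  -- lost its third neighbour, `z` must see both of them, and just one vertex more.
  have hzy' : G.Adj z y := by
    by_contra hcon
    obtain ⟨u, hzu, hua, hub⟩ := exists_third_adj (hlow z hzs) hz' a b
    rcases hNz u hzu (by rintro rfl; exact hcon hzu) with h | h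
    exacts [hua h, hub h]
  have hxab : x = a ∨ x = b :=
    hzab x ⟨hzy, hxy.ne, hzx, Or.inr (Or.inr ⟨rfl, hzy'.symm⟩)⟩
  obtain ⟨c, hc⟩ : ∃ c, ∀ u, G.Adj z u → u ≠ y → u = x ∨ u = c := by
    rcases hxab with rfl | rfl
    exacts [⟨b, hNz⟩, ⟨a, fun u hu huy => (hNz u hu huy).symm⟩]
  have hzx' : G.Adj z x := by
    by_contra hcon
    obtain ⟨u, hzu, huy, huc⟩ := exists_third_adj (hlow z hzs) hz' y c
    rcases hc u hzu huy with rfl | h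
    exacts [hcon hzu, huc h]
  obtain ⟨u, hzu, hux, huy⟩ := exists_third_adj (hlow z hzs) hz' x y
  have huc : u = c := (hc u hzu huy).resolve_left hux
  subst huc
  exact ⟨z, u, hzs, hzx', hzy', hzu, hux, huy, fun t ht => by
    by_cases hty : t = y
    · exact Or.inr (Or.inl hty)
    · exact (hc t ht hty).imp_right Or.inr⟩

/-- A finite graph without `K₄` minor and with an edge has, apart from any prescribed vertex, a
vertex with one or two neighbours. -/
theorem exists_isLowDegree [Finite V] (G : SimpleGraph V) (s : V)
    (hK : ¬ G.HasMinor (⊤ : SimpleGraph (Fin 4))) (hE : ∃ u w, G.Adj u w) :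
    ∃ v, v ≠ s ∧ G.IsLowDegree v := by
  induction hn : G.support.ncard using Nat.strong_induction_on generalizing G s with
  | _ n ih =>
    subst hn
    have IH : ∀ (H : SimpleGraph V) (r : V), ¬ H.HasMinor (⊤ : SimpleGraph (Fin 4)) →
        H.support ⊂ G.support → (∃ u w, H.Adj u w) → ∃ v, v ≠ r ∧ H.IsLowDegree v :=
      fun H r hH hss hE => ih _ (Set.ncard_lt_ncard hss (Set.toFinite _)) H r hH hE rfl
    by_contra! hlow
    obtain ⟨x, y, hxy, hys⟩ : ∃ x y, G.Adj x y ∧ y ≠ s := by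
      obtain ⟨u, w, huw⟩ := hE
      by_cases hw : w = s
      · exact ⟨w, u, huw.symm, hw ▸ huw.ne⟩
      · exact ⟨u, w, huw, hw⟩
    obtain ⟨z, w, hzs, hzx, hzy, hzw, hwx, hwy, hNz⟩ := exists_cubic_of_adj hK hlow IH hxy hys
    -- The edge from `z` to its third neighbour `w` has a cubic apex `z'` too. Being a neighbour of
    -- `z` other than `w`, it is `x` or `y`, and so a twin of `z`.
    obtain ⟨z', w', hz's, hz'w, hz'z, hz'w', hw'w, hw'z, hNz'⟩ :=
      exists_cubic_of_adj hK hlow IH hzw.symm hzs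
    have twins := fun a b => not_twins (x := z) (y := z') (a := a) (b := b) hK hlow
      (fun H r hle => IH H r fun h => hK (h.mono hle)) hzs hz's hz'z.symm
    rcases hNz z' hz'z.symm with rfl | rfl | h
    · have hyw' : y = w' := by
        rcases hNz' y hxy with h | h | h
        exacts [absurd h.symm hwy, absurd h hzy.ne', h]
      subst hyw'
      exact twins w y (fun u hu => by have := hNz u hu; tauto)
        (fun u hu => by have := hNz' u hu; tauto)
    · have hyw' : x = w' := by
        rcases hNz' x hxy.symm with h | h | h
        exacts [absurd h.symm hwx, absurd h hzx.ne', h]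
      subst hyw'
      exact twins w x (fun u hu => by have := hNz u hu; tauto)
        (fun u hu => by have := hNz' u hu; tauto)
    · exact hz'w.ne h

end SimpleGraph

/-! ### Cut capacities -/

section Cut

variable {V : Type*} [Fintype V]

open scoped Classical in
/-- The capacity of the arcs entering `U`. -/
noncomputable def cutCap (c : V → V → ℕ) (U : Set V) : ℕ :=
  ∑ u, ∑ w, if u ∉ U ∧ w ∈ U then c u w else 0

open scoped Classical in
/-- The capacity function of `p` parallel arcs from `a` to `b`. -/
noncomputable def arcCap (a b : V) (p : ℕ) (u w : V) : ℕ := if u = a ∧ w = b then p else 0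

theorem cutCap_add (c d : V → V → ℕ) (U : Set V) :
    cutCap (c + d) U = cutCap c U + cutCap d U := by
  classical
  simp only [cutCap, ← Finset.sum_add_distrib, Pi.add_apply]
  refine Finset.sum_congr rfl fun u _ => Finset.sum_congr rfl fun w _ => ?_
  split_ifs <;> rfl

open scoped Classical in
theorem cutCap_arcCap (a b : V) (p : ℕ) (U : Set V) :
    cutCap (arcCap a b p) U = if a ∉ U ∧ b ∈ U then p else 0 := by
  unfold cutCap arcCap
  rw [Finset.sum_eq_single a, Finset.sum_eq_single b]
  · simp
  · intro w _ hw
    simp [hw]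
  · simp
  · intro u _ hu
    simp [hu]
  · simp

theorem cutCap_congr {c : V → V → ℕ} {U U' : Set V}
    (h : ∀ u w, c u w ≠ 0 → ((u ∈ U ↔ u ∈ U') ∧ (w ∈ U ↔ w ∈ U'))) :
    cutCap c U = cutCap c U' := by
  classical
  refine Finset.sum_congr rfl fun u _ => Finset.sum_congr rfl fun w _ => ?_
  by_cases hc : c u w = 0
  · simp [hc]
  · simp [(h u w hc).1, (h u w hc).2]

theorem cutCap_eq_zero {c : V → V → ℕ} {U : Set V} (h : ∀ u w, u ∉ U → w ∈ U → c u w = 0) :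
    cutCap c U = 0 := by
  classical
  refine Finset.sum_eq_zero fun u _ => Finset.sum_eq_zero fun w _ => ?_
  split_ifs with huw
  · exact h u w huw.1 huw.2
  · rfl

end Cut

/-! ### Rooted trees and insertion of a vertex -/

/-- A tree rooted at `s`, encoded by parent pointers; the rank decreases towards the root. -/
structure ParentTree {V : Type*} (s : V) where
  verts : Set V
  root_mem : s ∈ verts
  parent : V → V
  rank : V → ℕ
  parent_mem : ∀ v ∈ verts, v ≠ s → parent v ∈ verts
  rank_parent_lt : ∀ v ∈ verts, v ≠ s → rank (parent v) < rank v

namespace ParentTree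

variable {V : Type*} {s : V} {k : ℕ}

/-- The tree uses the arc from `u` to `w`. -/
def Uses (T : ParentTree s) (u w : V) : Prop := w ∈ T.verts ∧ w ≠ s ∧ T.parent w = u

/-- The tree consisting of its root. -/
def trivial (s : V) : ParentTree s where
  verts := {s}
  root_mem := rfl
  parent := id
  rank := 0
  parent_mem := fun _ h _ => h
  rank_parent_lt := fun _ h h' => absurd h h'

open scoped Classical in
/-- The number of trees that use the arc from `u` to `w`. -/
noncomputable def load (T : Fin k → ParentTree s) (u w : V) : ℕ :=
  (Finset.univ.filter fun i => (T i).Uses u w).card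

open scoped Classical in
/-- The indices of the trees that contain `x`. -/
noncomputable def cover (T : Fin k → ParentTree s) (x : V) : Finset (Fin k) :=
  Finset.univ.filter fun i => x ∈ (T i).verts

theorem mem_cover {T : Fin k → ParentTree s} {x : V} {i : Fin k} :
    i ∈ cover T x ↔ x ∈ (T i).verts := by
  simp [cover]

theorem Uses.rank_lt {T : ParentTree s} {u w : V} (h : T.Uses u w) : T.rank u < T.rank w := by
  obtain ⟨h1, h2, rfl⟩ := h
  exact T.rank_parent_lt w h1 h2

theorem Uses.mem {T : ParentTree s} {u w : V} (h : T.Uses u w) : u ∈ T.verts := by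
  obtain ⟨h1, h2, rfl⟩ := h
  exact T.parent_mem w h1 h2

open scoped Classical in
/-- Insert a new vertex `v` as a child of `a`; if `b` is a child of `a` and `thr` holds, then `v`
becomes the parent of `b`. -/
noncomputable def insertVertex (T : ParentTree s) (v a b : V) (thr : Prop) (hvs : v ≠ s)
    (hv : v ∉ T.verts) (ha : a ∈ T.verts) (hthr : thr → T.Uses a b) : ParentTree s where
  verts := insert v T.verts
  root_mem := Set.mem_insert_of_mem _ T.root_mem
  parent := fun u => if u = v then a else if thr ∧ u = b then v else T.parent u
  -- Doubling makes room for an odd rank strictly between those of `a` and its child `b`.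
  rank := fun u => if u = v then 2 * T.rank a + 1 else 2 * T.rank u
  parent_mem := by
    intro u hu hus
    by_cases huv : u = v
    · simp [huv, ha]
    · have hu' : u ∈ T.verts := by simpa [huv] using hu
      simp only [huv, if_false]
      split_ifs
      · exact Set.mem_insert _ _
      · exact Set.mem_insert_of_mem _ (T.parent_mem u hu' hus)
  rank_parent_lt := by
    intro u hu hus
    by_cases huv : u = v
    · have : a ≠ v := by rintro rfl; exact hv ha
      simp [huv, this]
    · have hu' : u ∈ T.verts := by simpa [huv] using hu
      simp only [huv, if_false]
      by_cases h : thr ∧ u = b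
      · have := (hthr h.1).rank_lt
        obtain ⟨_, rfl⟩ := h
        simp_all
        omega
      · have h1 : T.parent u ≠ v := by
          intro h'
          exact hv (h' ▸ T.parent_mem u hu' hus)
        have := T.rank_parent_lt u hu' hus
        simp [h, h1, this]

theorem insertVertex_uses {T : ParentTree s} {v a b : V} {thr : Prop} {hvs : v ≠ s}
    {hv : v ∉ T.verts} {ha : a ∈ T.verts} {hthr : thr → T.Uses a b} {u w : V} :
    (T.insertVertex v a b thr hvs hv ha hthr).Uses u w ↔
      (w = v ∧ u = a) ∨ (thr ∧ w = b ∧ u = v) ∨ (T.Uses u w ∧ ¬ (thr ∧ w = b)) := by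
  unfold Uses insertVertex
  dsimp only
  by_cases hwv : w = v
  · subst hwv
    simp only [Set.mem_insert_iff, if_true, true_and, hv, false_and, or_false]
    constructor
    · rintro ⟨-, rfl⟩
      exact Or.inl rfl
    · rintro (rfl | ⟨h1, rfl, -⟩)
      · exact ⟨hvs, rfl⟩
      · exact absurd (hthr h1).1 hv
  · by_cases h : thr ∧ w = b
    · obtain ⟨h1, rfl⟩ := h
      have := hthr h1
      simp [hwv, h1, this.1, this.2.1, eq_comm]
    · simp only [hwv, Set.mem_insert_iff, false_or, if_false, h, false_and, not_false_eq_true,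
        and_true]
      tauto

end ParentTree

/-- A greedy choice of trees through which a new vertex with two neighbours is attached. -/
theorem exists_attachment {ι : Type*} [DecidableEq ι] (Na Nb Ma Mb : Finset ι) (α β : ℕ)
    (hMa : Ma ⊆ Na ∩ Nb) (hMb : Mb ⊆ Na ∩ Nb) (hdis : Disjoint Ma Mb) (hα : Ma.card ≤ α)
    (hβ : Mb.card ≤ β) :
    ∃ La Lb : Finset ι, Ma ⊆ La ∧ Mb ⊆ Lb ∧ La ⊆ Na ∧ Lb ⊆ Nb ∧ Disjoint La Lb ∧ La.card ≤ α ∧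
      Lb.card ≤ β ∧
      (∀ m, m ≤ α + β → m + Mb.card ≤ Na.card + β → m + Ma.card ≤ Nb.card + α →
        m ≤ (Na ∪ Nb).card → m ≤ (La ∪ Lb).card) ∧
      (∀ m, m + Mb.card ≤ Na.card + β → m ≤ (Na ∪ Nb).card → m ≤ (Na ∪ (La ∪ Lb)).card) ∧
      (∀ m, m + Ma.card ≤ Nb.card + α → m ≤ (Na ∪ Nb).card → m ≤ (Nb ∪ (La ∪ Lb)).card) := by
  -- Spare capacity goes first to indices in exactly one of `Na`, `Nb`, which can be served from one
  -- side only; common indices receive what is left.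
  obtain ⟨Ra, hRa, hra⟩ := Finset.exists_subset_card_eq
    (min_le_right (α - Ma.card) (Na \ Nb).card)
  obtain ⟨Rb, hRb, hrb⟩ := Finset.exists_subset_card_eq
    (min_le_right (β - Mb.card) (Nb \ Na).card)
  obtain ⟨Ca, hCa, hca⟩ := Finset.exists_subset_card_eq
    (min_le_right (α - Ma.card - Ra.card) ((Na ∩ Nb) \ (Ma ∪ Mb)).card)
  obtain ⟨Cb, hCb, hcb⟩ := Finset.exists_subset_card_eq
    (min_le_right (β - Mb.card - Rb.card) (((Na ∩ Nb) \ (Ma ∪ Mb)) \ Ca).card)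
  have ma : ∀ {i}, i ∈ Ma → i ∈ Na ∧ i ∈ Nb := fun h => by simpa using hMa h
  have mb : ∀ {i}, i ∈ Mb → i ∈ Na ∧ i ∈ Nb := fun h => by simpa using hMb h
  have ra : ∀ {i}, i ∈ Ra → i ∈ Na ∧ i ∉ Nb := fun h => by simpa using hRa h
  have rb : ∀ {i}, i ∈ Rb → i ∈ Nb ∧ i ∉ Na := fun h => by simpa using hRb h
  have ca : ∀ {i}, i ∈ Ca → (i ∈ Na ∧ i ∈ Nb) ∧ i ∉ Ma ∧ i ∉ Mb := fun h => by
    simpa using hCa h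
  have cb : ∀ {i}, i ∈ Cb → ((i ∈ Na ∧ i ∈ Nb) ∧ i ∉ Ma ∧ i ∉ Mb) ∧ i ∉ Ca := fun h => by
    simpa using hCb h
  have cLa : (Ma ∪ Ra ∪ Ca).card = Ma.card + Ra.card + Ca.card := by
    rw [Finset.card_union_of_disjoint, Finset.card_union_of_disjoint]
    · exact Finset.disjoint_left.2 fun i h h' => (ra h').2 (ma h).2
    · refine Finset.disjoint_left.2 fun i h h' => ?_
      rcases Finset.mem_union.1 h with h | h
      exacts [(ca h').2.1 h, (ra h).2 (ca h').1.2]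
  have cLb : (Mb ∪ Rb ∪ Cb).card = Mb.card + Rb.card + Cb.card := by
    rw [Finset.card_union_of_disjoint, Finset.card_union_of_disjoint]
    · exact Finset.disjoint_left.2 fun i h h' => (rb h').2 (mb h).1
    · refine Finset.disjoint_left.2 fun i h h' => ?_
      rcases Finset.mem_union.1 h with h | h
      exacts [(cb h').1.2.2 h, (rb h).2 (cb h').1.1.1]
  have dL : Disjoint (Ma ∪ Ra ∪ Ca) (Mb ∪ Rb ∪ Cb) := by
    refine Finset.disjoint_left.2 fun i h h' => ?_
    simp only [Finset.mem_union] at h h'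
    rcases h with (h | h) | h <;> rcases h' with (h' | h') | h'
    exacts [Finset.disjoint_left.1 hdis h h', (rb h').2 (ma h).1, (cb h').1.2.1 h,
      (ra h).2 (mb h').2, (ra h).2 (rb h').1, (ra h).2 (cb h').1.1.2,
      (ca h).2.2 h', (rb h').2 (ca h).1.1, (cb h').2 h]
  have cL := Finset.card_union_of_disjoint dL
  -- Relative to `Na`, only `Rb` contributes new indices.
  have hA : Na.card + Rb.card ≤ (Na ∪ (Ma ∪ Ra ∪ Ca ∪ (Mb ∪ Rb ∪ Cb))).card := by
    rw [← Finset.card_union_of_disjoint (Finset.disjoint_left.2 fun i h h' => (rb h').2 h)]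
    refine Finset.card_le_card (Finset.union_subset_union_right fun i h => ?_)
    simp [h]
  have hB : Nb.card + Ra.card ≤ (Nb ∪ (Ma ∪ Ra ∪ Ca ∪ (Mb ∪ Rb ∪ Cb))).card := by
    rw [← Finset.card_union_of_disjoint (Finset.disjoint_left.2 fun i h h' => (ra h').2 h)]
    refine Finset.card_le_card (Finset.union_subset_union_right fun i h => ?_)
    simp [h]
  have e1 : ((Na ∩ Nb) \ (Ma ∪ Mb)).card + (Ma.card + Mb.card) = (Na ∩ Nb).card := by
    rw [← Finset.card_union_of_disjoint hdis]
    exact Finset.card_sdiff_add_card_eq_card (Finset.union_subset hMa hMb)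
  have e2 := Finset.card_sdiff_add_card_eq_card hCa
  have e3 := Finset.card_sdiff_add_card_inter Na Nb
  have e4 := Finset.card_sdiff_add_card_inter Nb Na
  rw [Finset.inter_comm] at e4
  have e5 := Finset.card_union_add_card_inter Na Nb
  refine ⟨Ma ∪ Ra ∪ Ca, Mb ∪ Rb ∪ Cb, fun i h => ?_, fun i h => ?_, fun i h => ?_, fun i h => ?_,
    dL, ?_, ?_, ?_, ?_, ?_⟩
  · simp [h]
  · simp [h]
  · simp only [Finset.mem_union] at h
    rcases h with (h | h) | h
    exacts [(ma h).1, (ra h).1, (ca h).1.1]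
  · simp only [Finset.mem_union] at h
    rcases h with (h | h) | h
    exacts [(mb h).2, (rb h).1, (cb h).1.1.2]
  · omega
  · omega
  · intro m h1 h2 h3 h4
    omega
  · intro m h1 h2
    omega
  · intro m h1 h2
    omega

theorem Finset.exists_subset_card_sub {ι : Type*} [DecidableEq ι] {P : Finset ι} {n p : ℕ}
    (h : P.card ≤ n + p) : ∃ M ⊆ P, M.card ≤ p ∧ (P \ M).card ≤ n := by
  obtain ⟨M, hM, hc⟩ := Finset.exists_subset_card_eq (Nat.sub_le P.card n)
  have := Finset.card_sdiff_add_card_eq_card hM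
  exact ⟨M, hM, by omega, by omega⟩

namespace ParentTree

variable {V : Type*} {s : V} {k : ℕ}


open scoped Classical in
/-- Reinsertion of a vertex `v` with at most two neighbours into a family of trees. -/
theorem exists_insertVertex {c₀ : V → V → ℕ} {v a b : V} {α β γ δ : ℕ} (hvs : v ≠ s)
    (hab : a = b → β = 0 ∧ δ = 0) (hav : a ≠ v) (hbv : b ≠ v) (hc₀ : ∀ u, c₀ u v = 0)
    (T : Fin k → ParentTree s)
    (hT : ∀ u w, load T u w ≤ c₀ u w + arcCap a b (min α δ) u w + arcCap b a (min β γ) u w) :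
    ∃ T' : Fin k → ParentTree s,
      (∀ u w, load T' u w ≤ c₀ u w + arcCap a v α u w + arcCap b v β u w + arcCap v a γ u w +
        arcCap v b δ u w) ∧
      (∀ x, x ≠ v → cover T' x = cover T x) ∧
      (∀ m, m ≤ α + β → m + min β γ ≤ (cover T a).card + β →
        m + min α δ ≤ (cover T b).card + α → m ≤ (cover T a ∪ cover T b).card →
        m ≤ (cover T' v).card) ∧
      (∀ m, m + min β γ ≤ (cover T a).card + β → m ≤ (cover T a ∪ cover T b).card →
        m ≤ (cover T a ∪ cover T' v).card) ∧
      (∀ m, m + min α δ ≤ (cover T b).card + α → m ≤ (cover T a ∪ cover T b).card →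
        m ≤ (cover T b ∪ cover T' v).card) := by
  -- In the reduced network no capacity enters `v`, so no tree contains it.
  have hv : ∀ i, v ∉ (T i).verts := by
    intro i hi
    have h := hT ((T i).parent v) v
    simp only [hc₀, arcCap, hbv.symm, hav.symm, and_false, if_false, add_zero,
      Nat.le_zero, load, Finset.card_eq_zero] at h
    have : i ∈ Finset.univ.filter fun j => (T j).Uses ((T i).parent v) v :=
      Finset.mem_filter.2 ⟨Finset.mem_univ _, hi, hvs, rfl⟩
    simp [h] at this
  -- If `x = y` both arc terms count on the right, but no tree uses a loop.
  have hP : ∀ {x y : V} {p q : ℕ},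
      load T x y ≤ c₀ x y + arcCap x y p x y + arcCap y x q x y →
      load T x y ≤ c₀ x y + p := by
    intro x y p q h
    by_cases hxy : x = y
    · subst hxy
      have : load T x x = 0 := by
        rw [load, Finset.card_eq_zero, Finset.filter_eq_empty_iff]
        exact fun i _ hi => (hi.rank_lt).false
      omega
    · simpa [arcCap, hxy] using h
  -- Only the users of `a → b` in excess of `c₀ a b` need a detour through `v`; they number at most
  -- `min α δ`.
  obtain ⟨Ma, hMaP, hMa, hMa'⟩ := Finset.exists_subset_card_sub (hP (hT a b))
  obtain ⟨Mb, hMbP, hMb, hMb'⟩ := Finset.exists_subset_card_sub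
    (hP ((hT b a).trans_eq (add_right_comm _ _ _)))
  have useMa : ∀ {i}, i ∈ Ma → (T i).Uses a b := fun h => (Finset.mem_filter.1 (hMaP h)).2
  have useMb : ∀ {i}, i ∈ Mb → (T i).Uses b a := fun h => (Finset.mem_filter.1 (hMbP h)).2
  obtain ⟨La, Lb, hMLa, hMLb, hLa, hLb, hdis, hLaα, hLbβ, h1, h2, h3⟩ :=
    exists_attachment (cover T a) (cover T b) Ma Mb α β
      (fun i h => Finset.mem_inter.2 ⟨mem_cover.2 (useMa h).mem, mem_cover.2 (useMa h).1⟩)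
      (fun i h => Finset.mem_inter.2 ⟨mem_cover.2 (useMb h).1, mem_cover.2 (useMb h).mem⟩)
      (Finset.disjoint_left.2 fun i h h' => ((useMa h).rank_lt.trans (useMb h').rank_lt).false)
      (hMa.trans (min_le_left _ _)) (hMb.trans (min_le_left _ _))
  have hdis' := Finset.disjoint_left.1 hdis
  -- Trees in `La` receive `v` as a child of `a`, and those in `Ma` also move `b` below `v`;
  -- symmetrically for `Lb` and `Mb`.
  let T' : Fin k → ParentTree s := fun i =>
    if ha : i ∈ La then
      (T i).insertVertex v a b (i ∈ Ma) hvs (hv i) (mem_cover.1 (hLa ha)) useMa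
    else if hb : i ∈ Lb then
      (T i).insertVertex v b a (i ∈ Mb) hvs (hv i) (mem_cover.1 (hLb hb)) useMb
    else T i
  have hverts : ∀ i x, x ∈ (T' i).verts ↔ x ∈ (T i).verts ∨ (x = v ∧ (i ∈ La ∨ i ∈ Lb)) := by
    intro i x
    by_cases ha : i ∈ La
    · simp [T', ha, insertVertex, or_comm]
    · by_cases hb : i ∈ Lb
      · simp [T', ha, hb, insertVertex, or_comm]
      · simp [T', ha, hb]
  have huses : ∀ i u w, (T' i).Uses u w →
      ((T i).Uses u w ∧ ¬ (i ∈ Ma ∧ w = b) ∧ ¬ (i ∈ Mb ∧ w = a)) ∨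
      (i ∈ La ∧ u = a ∧ w = v) ∨ (i ∈ Lb ∧ u = b ∧ w = v) ∨
      (i ∈ Mb ∧ u = v ∧ w = a) ∨ (i ∈ Ma ∧ u = v ∧ w = b) := by
    intro i u w h
    by_cases ha : i ∈ La
    · have hb : i ∉ Mb := fun h => hdis' ha (hMLb h)
      simp only [T', ha, dif_pos, insertVertex_uses] at h
      rcases h with ⟨h1, h2⟩ | ⟨h1, h2, h3⟩ | ⟨h1, h2⟩
      exacts [Or.inr (Or.inl ⟨ha, h2, h1⟩), Or.inr (Or.inr (Or.inr (Or.inr ⟨h1, h3, h2⟩))),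
        Or.inl ⟨h1, h2, fun h => hb h.1⟩]
    · have ha' : i ∉ Ma := fun h => ha (hMLa h)
      by_cases hb : i ∈ Lb
      · simp only [T', ha, hb, dif_pos, dif_neg, not_false_eq_true, insertVertex_uses] at h
        rcases h with ⟨h1, h2⟩ | ⟨h1, h2, h3⟩ | ⟨h1, h2⟩
        exacts [Or.inr (Or.inr (Or.inl ⟨hb, h2, h1⟩)),
          Or.inr (Or.inr (Or.inr (Or.inl ⟨h1, h3, h2⟩))), Or.inl ⟨h1, fun h => ha' h.1, h2⟩]
      · have hb' : i ∉ Mb := fun h => hb (hMLb h)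
        simp only [T', ha, hb, dif_neg, not_false_eq_true] at h
        exact Or.inl ⟨h, fun h => ha' h.1, fun h => hb' h.1⟩
  have hcover : cover T' v = La ∪ Lb := by
    ext i
    simp [mem_cover, hverts, hv]
  refine ⟨T', fun u w => ?_, fun x hx => ?_, fun m m1 m2 m3 m4 => ?_, fun m m2 m4 => ?_,
    fun m m3 m4 => ?_⟩
  · have hfilter : ∀ (L : Finset (Fin k)) (n : ℕ) (x y : V), L.card ≤ n →
        (L.filter fun _ => u = x ∧ w = y).card ≤ arcCap x y n u w := by
      intro L n x y hL
      unfold arcCap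
      split_ifs with h
      · exact (Finset.card_filter_le _ _).trans hL
      · simp [h]
    have hold : (Finset.univ.filter fun i =>
        (T i).Uses u w ∧ ¬ (i ∈ Ma ∧ w = b) ∧ ¬ (i ∈ Mb ∧ w = a)).card ≤ c₀ u w := by
      by_cases h1 : u = a ∧ w = b
      · obtain ⟨rfl, rfl⟩ := h1
        refine (Finset.card_le_card fun i hi => ?_).trans hMa'
        simp only [Finset.mem_filter, Finset.mem_univ, true_and, and_true, Finset.mem_sdiff] at hi ⊢
        exact ⟨hi.1, hi.2.1⟩
      · by_cases h2 : u = b ∧ w = a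
        · obtain ⟨rfl, rfl⟩ := h2
          refine (Finset.card_le_card fun i hi => ?_).trans hMb'
          simp only [Finset.mem_filter, Finset.mem_univ, true_and, and_true,
            Finset.mem_sdiff] at hi ⊢
          exact ⟨hi.1, hi.2.2⟩
        · have := hT u w
          simp only [arcCap, h1, h2, if_false, add_zero] at this
          refine (Finset.card_le_card fun i hi => ?_).trans this
          simp only [Finset.mem_filter, Finset.mem_univ, true_and] at hi ⊢
          exact hi.1
    have hsub : (Finset.univ.filter fun i => (T' i).Uses u w) ⊆
        ((((Finset.univ.filter fun i =>
            (T i).Uses u w ∧ ¬ (i ∈ Ma ∧ w = b) ∧ ¬ (i ∈ Mb ∧ w = a)) ∪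
          La.filter fun _ => u = a ∧ w = v) ∪ Lb.filter fun _ => u = b ∧ w = v) ∪
          Mb.filter fun _ => u = v ∧ w = a) ∪ Ma.filter fun _ => u = v ∧ w = b := by
      intro i hi
      simp only [Finset.mem_union, Finset.mem_filter, Finset.mem_univ, true_and, or_assoc]
      exact huses i u w (Finset.mem_filter.1 hi).2
    refine (Finset.card_le_card hsub).trans ?_
    refine (Finset.card_union_le _ _).trans (add_le_add ?_ (hfilter _ _ _ _ (hMa.trans
      (min_le_right _ _))))
    refine (Finset.card_union_le _ _).trans (add_le_add ?_ (hfilter _ _ _ _ (hMb.trans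
      (min_le_right _ _))))
    refine (Finset.card_union_le _ _).trans (add_le_add ?_ (hfilter _ _ _ _ hLbβ))
    exact (Finset.card_union_le _ _).trans (add_le_add hold (hfilter _ _ _ _ hLaα))
  · ext i
    simp [mem_cover, hverts, hx]
  · rw [hcover]
    exact h1 m m1 ((Nat.add_le_add_left hMb _).trans m2) ((Nat.add_le_add_left hMa _).trans m3) m4
  · rw [hcover]
    exact h2 m ((Nat.add_le_add_left hMb _).trans m2) m4
  · rw [hcover]
    exact h3 m ((Nat.add_le_add_left hMa _).trans m3) m4

end ParentTree

/-! ### Cuts under removal of a vertex with two neighbours -/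

section Packing

variable {V : Type*} [Fintype V] {s : V} {k : ℕ}

/-- Every cut separating the root from both `x` and `y` has capacity at least `m`. -/
def IsCutBound (c : V → V → ℕ) (s x y : V) (m : ℕ) : Prop :=
  ∀ U : Set V, s ∉ U → x ∈ U → y ∈ U → m ≤ cutCap c U

theorem IsCutBound.symm {c : V → V → ℕ} {s x y : V} {m : ℕ} (h : IsCutBound c s x y m) :
    IsCutBound c s y x m := fun U hs hy hx => h U hs hx hy

section Reduction

variable {c₀ : V → V → ℕ} {v a b : V} {α β γ δ : ℕ}

open scoped Classical in
theorem cutCap_insert_of_two_neighbors (hav : a ≠ v) (hbv : b ≠ v) (hc₀ : ∀ u, c₀ u v = 0)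
    (hc₀' : ∀ w, c₀ v w = 0) (U : Set V) :
    cutCap (c₀ + arcCap a v α + arcCap b v β + arcCap v a γ + arcCap v b δ) (insert v U) =
      cutCap c₀ U + (if a ∈ U then 0 else α) + (if b ∈ U then 0 else β) := by
  have h0 : cutCap c₀ (insert v U) = cutCap c₀ U := cutCap_congr fun u w huw => by
    have hu : u ≠ v := by rintro rfl; exact huw (hc₀' w)
    have hw : w ≠ v := by rintro rfl; exact huw (hc₀ u)
    simp [hu, hw]
  simp only [cutCap_add, cutCap_arcCap, h0]
  simp [hav, hbv, ite_not]

open scoped Classical in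
theorem cutCap_of_two_neighbors {U : Set V} (hvU : v ∉ U) :
    cutCap (c₀ + arcCap a v α + arcCap b v β + arcCap v a γ + arcCap v b δ) U =
      cutCap c₀ U + (if a ∈ U then γ else 0) + (if b ∈ U then δ else 0) := by
  simp only [cutCap_add, cutCap_arcCap]
  simp [hvU]

open scoped Classical in
theorem cutCap_reduction (U : Set V) :
    cutCap (c₀ + arcCap a b (min α δ) + arcCap b a (min β γ)) U =
      cutCap c₀ U + (if a ∉ U ∧ b ∈ U then min α δ else 0) +
        (if b ∉ U ∧ a ∈ U then min β γ else 0) := by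
  simp only [cutCap_add, cutCap_arcCap]

/-- No capacity touches `v` in the reduced network, so `v` may be dropped from any cut. -/
theorem cutCap_reduction_sdiff (hav : a ≠ v) (hbv : b ≠ v) (hc₀ : ∀ u, c₀ u v = 0)
    (hc₀' : ∀ w, c₀ v w = 0) (p q : ℕ) (U : Set V) :
    cutCap (c₀ + arcCap a b p + arcCap b a q) (U \ {v}) =
      cutCap (c₀ + arcCap a b p + arcCap b a q) U := by
  classical
  have h0 : cutCap c₀ (U \ {v}) = cutCap c₀ U := cutCap_congr fun u w huw => by
    have hu : u ≠ v := by rintro rfl; exact huw (hc₀' w)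
    have hw : w ≠ v := by rintro rfl; exact huw (hc₀ u)
    simp [hu, hw]
  simp only [cutCap_add, cutCap_arcCap, h0]
  simp [hav, hbv]

/-- Cuts separating the root from old vertices do not lose capacity in the reduction. -/
theorem IsCutBound.reduction (hvs : v ≠ s) (hav : a ≠ v) (hbv : b ≠ v) (hc₀ : ∀ u, c₀ u v = 0)
    (hc₀' : ∀ w, c₀ v w = 0) {x y : V} {m : ℕ} (hx : x ≠ v) (hy : y ≠ v)
    (h : IsCutBound (c₀ + arcCap a v α + arcCap b v β + arcCap v a γ + arcCap v b δ) s x y m) :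
    IsCutBound (c₀ + arcCap a b (min α δ) + arcCap b a (min β γ)) s x y m := by
  classical
  intro U hsU hxU hyU
  rw [← cutCap_reduction_sdiff hav hbv hc₀ hc₀']
  -- The reduced cut is the smaller of the two original cuts, with `v` inside and with `v` outside;
  -- this explains the minima.
  have h1 := h (insert v (U \ {v})) (by simp [hvs.symm, hsU])
    (Set.mem_insert_of_mem _ ⟨hxU, hx⟩) (Set.mem_insert_of_mem _ ⟨hyU, hy⟩)
  have h2 := h (U \ {v}) (fun h => hsU h.1) ⟨hxU, hx⟩ ⟨hyU, hy⟩
  rw [cutCap_insert_of_two_neighbors hav hbv hc₀ hc₀'] at h1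
  rw [cutCap_of_two_neighbors (by simp)] at h2
  rw [cutCap_reduction]
  by_cases ha : a ∈ U \ {v} <;> by_cases hb : b ∈ U \ {v} <;>
    simp only [ha, hb, if_true, if_false, not_true_eq_false, not_false_eq_true, and_true,
      and_false, add_zero] at h1 h2 ⊢ <;> omega

/-- A bound for cuts around `v` and `a` gives bounds for cuts around `a` and around `a`, `b`. -/
theorem IsCutBound.reduction_left (hvs : v ≠ s) (hav : a ≠ v) (hbv : b ≠ v)
    (hc₀ : ∀ u, c₀ u v = 0) (hc₀' : ∀ w, c₀ v w = 0) {m : ℕ}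
    (h : ∀ U : Set V, s ∉ U → v ∈ U → a ∈ U →
      m ≤ cutCap (c₀ + arcCap a v α + arcCap b v β + arcCap v a γ + arcCap v b δ) U) :
    IsCutBound (c₀ + arcCap a b (min α δ) + arcCap b a (min β γ)) s a a
      (m - (β - min β γ)) ∧
    IsCutBound (c₀ + arcCap a b (min α δ) + arcCap b a (min β γ)) s a b m := by
  classical
  have key : ∀ U : Set V, s ∉ U → a ∈ U →
      m ≤ cutCap c₀ U + (if b ∈ U then 0 else β) := by
    intro U hs ha
    have h1 := h (insert v U) (by simp [hvs.symm, hs]) (Set.mem_insert _ _)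
      (Set.mem_insert_of_mem _ ha)
    rwa [cutCap_insert_of_two_neighbors hav hbv hc₀ hc₀', if_pos ha, add_zero] at h1
  -- If `b ∉ U`, the reduced cut regains only `min β γ` of the `β` counted in `key`, hence the
  -- correction in the first bound.
  constructor
  · intro U hs ha _
    have h1 := key U hs ha
    rw [cutCap_reduction]
    by_cases hb : b ∈ U <;>
      simp only [ha, hb, if_true, if_false, not_true_eq_false, not_false_eq_true, and_true,
        and_false, add_zero] at h1 ⊢ <;> omega
  · intro U hs ha hb
    have h1 := key U hs ha
    rw [cutCap_reduction]
    simp only [ha, hb, if_true, not_true_eq_false, false_and, if_false, add_zero] at h1 ⊢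
    exact h1

end Reduction

end Packing

/-! ### The tree packing theorem -/

theorem SimpleGraph.IsLowDegree.exists_adj {V : Type*} {G : SimpleGraph V} {v : V} (h : G.IsLowDegree v) :
    ∃ a b, G.Adj v a ∧ G.Adj v b ∧ ∀ w, G.Adj v w → w = a ∨ w = b := by
  obtain ⟨a, b, ha, hab⟩ := h
  by_cases hb : G.Adj v b
  · exact ⟨a, b, ha, hb, hab⟩
  · refine ⟨a, a, ha, ha, fun w hw => (hab w hw).imp_right ?_⟩
    rintro rfl
    exact absurd hw hb

/-- Arcs at `v` are split off by neighbour. If `a = b`, all of them are credited to `a`, so that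
nothing is counted twice. -/
theorem exists_capacity_decomposition {V : Type*} {G : SimpleGraph V} {c : V → V → ℕ}
    (hc : ∀ u w, c u w ≠ 0 → G.Adj u w) {v a b : V} (hav : a ≠ v) (hbv : b ≠ v)
    (hN : ∀ w, G.Adj v w → w = a ∨ w = b) :
    ∃ (c₀ : V → V → ℕ) (α β γ δ : ℕ), (a = b → β = 0 ∧ δ = 0) ∧ (∀ u, c₀ u v = 0) ∧
      (∀ w, c₀ v w = 0) ∧ (∀ u w, c₀ u w ≠ 0 → G.Adj u w) ∧
      c = c₀ + arcCap a v α + arcCap b v β + arcCap v a γ + arcCap v b δ := by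
  classical
  refine ⟨fun u w => if u = v ∨ w = v then 0 else c u w, c a v, if a = b then 0 else c b v,
    c v a, if a = b then 0 else c v b, fun h => by simp [h], fun u => by simp, fun w => by simp,
    fun u w h => hc u w fun h' => h (by simp [h']), ?_⟩
  have hin : ∀ u, u ≠ a → u ≠ b → c u v = 0 := fun u ha hb => by
    by_contra h
    exact (hN u (hc u v h).symm).elim ha hb
  have hout : ∀ w, w ≠ a → w ≠ b → c v w = 0 := fun w ha hb => by
    by_contra h
    exact (hN w (hc v w h)).elim ha hb
  have hvv : c v v = 0 := hin v hav.symm hbv.symm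
  funext u w
  simp only [Pi.add_apply, arcCap]
  by_cases hw : w = v
  · subst hw
    by_cases hua : u = a
    · subst hua
      by_cases hub : u = b <;> simp [hub, hav, hbv]
    · by_cases hub : u = b
      · subst hub
        simp [hua, Ne.symm hua, hbv]
      · simp [hua, hub, hin u hua hub, hav.symm, hbv.symm]
  · by_cases hu : u = v
    · subst hu
      by_cases hwa : w = a
      · subst hwa
        by_cases hwb : w = b <;> simp [hwb, hav, hbv]
      · by_cases hwb : w = b
        · subst hwb
          simp [hwa, Ne.symm hwa, hbv]
        · simp [hwa, hwb, hout w hwa hwb, hav.symm, hbv.symm]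
    · simp [hu, hw]

open ParentTree in
/-- Tree packing in graphs without `K₄` minor: simultaneously for all vertices and all adjacent
pairs of vertices, as many of `k` arc-disjoint trees rooted at `s` as the cuts allow reach the
vertex or one of the pair. -/
theorem exists_treePacking {V : Type*} [Fintype V] (G : SimpleGraph V)
    (hK : ¬ G.HasMinor (⊤ : SimpleGraph (Fin 4))) (c : V → V → ℕ)
    (hc : ∀ u w, c u w ≠ 0 → G.Adj u w) (s : V) (k : ℕ) :
    ∃ T : Fin k → ParentTree s, (∀ u w, load T u w ≤ c u w) ∧
      ∀ x y, (x = y ∨ G.Adj x y) → ∀ m ≤ k, IsCutBound c s x y m →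
        m ≤ (cover T x ∪ cover T y).card := by
  classical
  induction hn : G.support.ncard using Nat.strong_induction_on generalizing G c with
  | _ n ih =>
    subst hn
    by_cases hE : ∃ u w, G.Adj u w
    · obtain ⟨v, hvs, hlow⟩ := G.exists_isLowDegree s hK hE
      obtain ⟨a, b, hva, hvb, hN⟩ := hlow.exists_adj
      have hav : a ≠ v := hva.ne'
      have hbv : b ≠ v := hvb.ne'
      obtain ⟨c₀, α, β, γ, δ, hab, hc₀, hc₀', hc₀G, rfl⟩ :=
        exists_capacity_decomposition hc hav hbv hN
      have hG' : ∀ u w, G.Adj u w → u ≠ v → w ≠ v → (G.contractInto a v).Adj u w :=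
        fun u w h hu hw => ⟨hu, hw, h.ne, Or.inl h⟩
      have hG'ab : a = b ∨ (G.contractInto a v).Adj a b :=
        or_iff_not_imp_left.2 fun h => ⟨hav, hbv, h, Or.inr (Or.inl ⟨rfl, hvb⟩)⟩
      obtain ⟨T, hT, hcov⟩ := ih _
        (Set.ncard_lt_ncard (SimpleGraph.support_contractInto_ssubset hva) (Set.toFinite _))
        (G.contractInto a v) (fun h => hK (h.of_contractInto hva))
        (c₀ + arcCap a b (min α δ) + arcCap b a (min β γ)) (by
          -- The new arcs run along the edge `ab` of the contracted graph; if `a = b`, their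
          -- capacities vanish because `β = δ = 0`.
          intro u w huw
          by_cases h1 : c₀ u w = 0
          · have hne : a ≠ b := by
              intro h
              simp [arcCap, h1, (hab h).1, (hab h).2] at huw
            have hadj := hG'ab.resolve_left hne
            by_cases h2 : u = a ∧ w = b
            · rw [h2.1, h2.2]
              exact hadj
            · by_cases h3 : u = b ∧ w = a
              · rw [h3.1, h3.2]
                exact hadj.symm
              · simp [arcCap, h1, h2, h3] at huw
          · exact hG' u w (hc₀G u w h1) (fun h => h1 (h ▸ hc₀' w)) (fun h => h1 (h ▸ hc₀ u))) rfl
      obtain ⟨T', hT', hsame, hv, hva', hvb'⟩ :=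
        exists_insertVertex hvs hab hav hbv hc₀ T hT
      -- The shortfall in trees at `a` is at most `β - min β γ`, the capacity of `b → v` that
      -- rerouting surely leaves free.
      have left : ∀ m ≤ k, (∀ U : Set V, s ∉ U → v ∈ U → a ∈ U → m ≤ cutCap
          (c₀ + arcCap a v α + arcCap b v β + arcCap v a γ + arcCap v b δ) U) →
          m + min β γ ≤ (cover T a).card + β ∧ m ≤ (cover T a ∪ cover T b).card := by
        intro m hm h
        obtain ⟨h1, h2⟩ := IsCutBound.reduction_left hvs hav hbv hc₀ hc₀' h
        have h3 := hcov a a (Or.inl rfl) _ (by omega) h1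
        rw [Finset.union_self] at h3
        exact ⟨by omega, hcov a b hG'ab m hm h2⟩
      have right : ∀ m ≤ k, (∀ U : Set V, s ∉ U → v ∈ U → b ∈ U → m ≤ cutCap
          (c₀ + arcCap a v α + arcCap b v β + arcCap v a γ + arcCap v b δ) U) →
          m + min α δ ≤ (cover T b).card + α ∧ m ≤ (cover T a ∪ cover T b).card := by
        intro m hm h
        have e1 : c₀ + arcCap a v α + arcCap b v β + arcCap v a γ + arcCap v b δ =
          c₀ + arcCap b v β + arcCap a v α + arcCap v b δ + arcCap v a γ := by abel
        have e2 : c₀ + arcCap b a (min β γ) + arcCap a b (min α δ) =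
          c₀ + arcCap a b (min α δ) + arcCap b a (min β γ) := by abel
        rw [e1] at h
        obtain ⟨h1, h2⟩ := IsCutBound.reduction_left hvs hbv hav hc₀ hc₀' h
        rw [e2] at h1 h2
        have h3 := hcov b b (Or.inl rfl) _ (by omega) h1
        rw [Finset.union_self] at h3
        exact ⟨by omega, hcov a b hG'ab m hm h2.symm⟩
      have pair : ∀ y, G.Adj v y → ∀ m ≤ k, IsCutBound
          (c₀ + arcCap a v α + arcCap b v β + arcCap v a γ + arcCap v b δ) s v y m →
          m ≤ (cover T' v ∪ cover T' y).card := by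
        intro y hy m hm h
        rw [Finset.union_comm, hsame y hy.ne']
        rcases hN y hy with rfl | rfl
        · obtain ⟨h1, h2⟩ := left m hm h
          exact hva' m h1 h2
        · obtain ⟨h1, h2⟩ := right m hm h
          exact hvb' m h1 h2
      refine ⟨T', hT', fun x y hxy m hm h => ?_⟩
      by_cases hx : x = v
      · subst hx
        rcases hxy with rfl | hxy
        · rw [Finset.union_self]
          obtain ⟨h1, h2⟩ := left m hm fun U hs hx _ => h U hs hx hx
          obtain ⟨h3, -⟩ := right m hm fun U hs hx _ => h U hs hx hx
          refine hv m ?_ h1 h3 h2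
          -- The cut `{v}` bounds `m` by the in-capacity `α + β`.
          have := h (insert x ∅) (by simp [hvs.symm]) (Set.mem_insert _ _) (Set.mem_insert _ _)
          rw [cutCap_insert_of_two_neighbors hav hbv hc₀ hc₀',
            cutCap_eq_zero (fun u w _ hw => hw.elim)] at this
          simpa using this
        · exact pair y hxy m hm h
      · by_cases hy : y = v
        · subst hy
          rw [Finset.union_comm]
          exact pair x (hxy.resolve_left hx).symm m hm h.symm
        · rw [hsame x hx, hsame y hy]
          exact hcov x y (hxy.imp_right fun h => hG' x y h hx hy) m hm
            (h.reduction hvs hav hbv hc₀ hc₀' hx hy)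
    · refine ⟨fun _ => ParentTree.trivial s, fun u w => ?_, fun x y hxy m hm h => ?_⟩
      · rw [load, Finset.card_eq_zero.2]
        · exact Nat.zero_le _
        · rw [Finset.filter_eq_empty_iff]
          exact fun i _ hi => hi.2.1 hi.1
      · have hxy' : x = y := hxy.resolve_right fun h => hE ⟨x, y, h⟩
        subst hxy'
        by_cases hx : x = s
        · subst hx
          have : cover (fun _ : Fin k => ParentTree.trivial x) x = Finset.univ := by
            ext i
            simp [mem_cover, ParentTree.root_mem]
          simpa [this] using hm
        · have := h {x} (Ne.symm hx) rfl rfl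
          rw [cutCap_eq_zero] at this
          · omega
          · intro u w _ _
            by_contra hcon
            exact hE ⟨u, w, hc u w hcon⟩

/-! ### Cuts bound flows, packings and codes -/

namespace MulticastNetwork

variable {V A : Type*}

section Cuts

variable [Fintype A]

open scoped Classical in
/-- The arcs that enter the vertex set `U`. -/
noncomputable def entering (D : MulticastNetwork V A) (U : Set V) : Finset A :=
  Finset.univ.filter fun e => D.tail e ∉ U ∧ D.head e ∈ U

theorem mem_entering {D : MulticastNetwork V A} {U : Set V} {e : A} :
    e ∈ D.entering U ↔ D.tail e ∉ U ∧ D.head e ∈ U := by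
  simp [entering]

open scoped Classical in
/-- The number of arcs from `u` to another vertex `w`. -/
noncomputable def capacity (D : MulticastNetwork V A) (u w : V) : ℕ :=
  if u = w then 0 else (Finset.univ.filter fun e => D.tail e = u ∧ D.head e = w).card

theorem topology_adj_of_capacity_ne_zero {D : MulticastNetwork V A} {u w : V}
    (h : D.capacity u w ≠ 0) : D.topology.Adj u w := by
  classical
  unfold capacity at h
  split_ifs at h with huw
  · exact absurd rfl h
  · obtain ⟨e, he⟩ := Finset.card_ne_zero.1 h
    exact (SimpleGraph.fromRel_adj _ _ _).2 ⟨huw, Or.inl ⟨e, (Finset.mem_filter.1 he).2⟩⟩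

theorem cutCap_capacity [Fintype V] (D : MulticastNetwork V A) (U : Set V) :
    cutCap D.capacity U = (D.entering U).card := by
  classical
  rw [Finset.card_eq_sum_card_fiberwise (f := fun e => (D.tail e, D.head e)) (t := Finset.univ)
    (fun _ _ => Finset.mem_coe.2 (Finset.mem_univ _)), Fintype.sum_prod_type]
  refine Finset.sum_congr rfl fun u _ => Finset.sum_congr rfl fun w _ => ?_
  split_ifs with h
  · have huw : u ≠ w := by rintro rfl; exact h.1 h.2
    rw [capacity, if_neg huw]
    congr 1
    ext e
    simp only [Finset.mem_filter, Finset.mem_univ, true_and, mem_entering, Prod.mk.injEq]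
    constructor
    · rintro ⟨rfl, rfl⟩
      exact ⟨h, rfl, rfl⟩
    · exact fun h => h.2
  · symm
    rw [Finset.card_eq_zero, Finset.filter_eq_empty_iff]
    rintro e he heq
    obtain ⟨rfl, rfl⟩ := Prod.mk.inj heq
    exact h (mem_entering.1 he)

theorem Reaches.exists_mem_entering {D : MulticastNetwork V A} {F : Set A} {t : V}
    (h : D.Reaches F t) {U : Set V} (hs : D.source ∉ U) (ht : t ∈ U) :
    ∃ e ∈ F, e ∈ D.entering U := by
  induction h with
  | refl => exact absurd ht hs
  | @tail u w _ huw ih =>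
    by_cases hu : u ∈ U
    · exact ih hu
    · obtain ⟨e, he, rfl, rfl⟩ := huw
      exact ⟨e, he, mem_entering.2 ⟨hu, ht⟩⟩

/-- Each tree enters `U` through an arc of its own. -/
theorem HasTreePacking.le_card_entering {D : MulticastNetwork V A} {k : ℕ}
    (h : D.HasTreePacking k) {t : V} (ht : t ∈ D.receivers) {U : Set V} (hs : D.source ∉ U)
    (htU : t ∈ U) : k ≤ (D.entering U).card := by
  obtain ⟨F, hdis, hF⟩ := h
  choose e heF he using fun i => ((hF i).2 t ht).exists_mem_entering hs htU
  simpa using Finset.card_le_card_of_injOn (s := Finset.univ) e (fun i _ => he i)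
    fun i _ j _ hij => by
      by_contra hne
      exact Set.disjoint_left.1 (hdis hne) (heF i) (hij ▸ heF j)

open scoped Classical in
theorem netInflow_eq_sum (D : MulticastNetwork V A) (f : A → ℝ) (v : V) :
    D.netInflow f v =
      ∑ e, f e * ((if D.head e = v then 1 else 0) - (if D.tail e = v then 1 else 0)) := by
  simp only [netInflow, mul_sub, mul_ite, mul_one, mul_zero, Finset.sum_sub_distrib,
    Finset.sum_filter]

/-- Summed over `U`, net inflow survives only at `t`, while arcs inside `U` cancel; entering arcs
contribute at most one and leaving arcs at most zero. -/
theorem IsFlowTo.netInflow_le [Fintype V] {D : MulticastNetwork V A} {t : V} {f : A → ℝ}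
    (hf : D.IsFlowTo t f) {U : Set V} (hs : D.source ∉ U) (ht : t ∈ U) :
    D.netInflow f t ≤ (D.entering U).card := by
  classical
  have h1 : D.netInflow f t = ∑ v with v ∈ U, D.netInflow f v := by
    refine (Finset.sum_eq_single t (fun v hv hvt => ?_) fun h => ?_).symm
    · exact hf.2 v (by rintro rfl; exact hs (Finset.mem_filter.1 hv).2) hvt
    · exact absurd (Finset.mem_filter.2 ⟨Finset.mem_univ _, ht⟩) h
  have h2 : ∀ x : V, (∑ v with v ∈ U, if x = v then (1 : ℝ) else 0) = if x ∈ U then 1 else 0 := by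
    intro x
    simp [Finset.sum_ite_eq]
  rw [h1]
  simp only [netInflow_eq_sum]
  rw [Finset.sum_comm]
  have h3 : ((D.entering U).card : ℝ) = ∑ e, if e ∈ D.entering U then (1 : ℝ) else 0 := by
    simp
  rw [h3]
  refine Finset.sum_le_sum fun e _ => ?_
  rw [← Finset.mul_sum, Finset.sum_sub_distrib, h2, h2]
  have h0 := (hf.1 e).1
  have h1 := (hf.1 e).2
  simp only [mem_entering]
  by_cases ha : D.tail e ∈ U <;> by_cases hb : D.head e ∈ U <;> simp [ha, hb, h0, h1]

/-- By induction on slots: an arc starting inside `U` depends on earlier symbols on arcs with head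
in `U`. Causality in time makes this work despite directed cycles. -/
theorem NetworkCode.symbol_eq_of_entering {D : MulticastNetwork V A} {m q n : ℕ}
    (C : D.NetworkCode m q n) {U : Set V} (hs : D.source ∉ U) {x y : Fin m}
    (h : ∀ e ∈ D.entering U, ∀ j, C.symbol x e j = C.symbol y e j) (j : Fin n) :
    ∀ e, D.head e ∈ U → C.symbol x e j = C.symbol y e j := by
  induction j using WellFoundedLT.induction with
  | ind j ih =>
    intro e he
    by_cases ht : D.tail e ∈ U
    · exact C.causal e (by rintro h; exact hs (h ▸ ht)) j x y
        fun e' he' j' hj' => ih j' hj' e' (he' ▸ ht)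
    · exact h e (mem_entering.2 ⟨ht, he⟩) j

/-- What crosses into `U` over all slots determines the message. -/
theorem NetworkCode.messages_le {D : MulticastNetwork V A} {m q n : ℕ}
    (C : D.NetworkCode m q n) {t : V} (ht : t ∈ D.receivers) {U : Set V} (hs : D.source ∉ U)
    (htU : t ∈ U) : m ≤ q ^ (n * (D.entering U).card) := by
  classical
  have hinj : Function.Injective fun (x : Fin m) (e : D.entering U) => C.symbol x e := by
    intro x y hxy
    refine C.decodable t ht x y fun e he j =>
      C.symbol_eq_of_entering hs (fun e he j => ?_) j e (he ▸ htU)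
    exact congr_fun (congr_fun hxy ⟨e, he⟩) j
  simpa [pow_mul] using Fintype.card_le_of_injective _ hinj

theorem codingRates_le {D : MulticastNetwork V A} {t : V} (ht : t ∈ D.receivers) {U : Set V}
    (hs : D.source ∉ U) (htU : t ∈ U) {r : ℝ} (hr : r ∈ D.codingRates) :
    r ≤ (D.entering U).card := by
  obtain ⟨m, q, n, hm, hq, hn, ⟨C⟩, rfl⟩ := hr
  have hlog : 0 < Real.log q := Real.log_pos (by exact_mod_cast hq)
  have hn' : (0 : ℝ) < n := by exact_mod_cast hn
  rw [div_le_iff₀ (mul_pos hn' hlog)]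
  have h1 : (m : ℝ) ≤ (q : ℝ) ^ (n * (D.entering U).card) := by
    exact_mod_cast C.messages_le ht hs htU
  have h2 := Real.log_le_log (by exact_mod_cast hm) h1
  rw [Real.log_pow] at h2
  push_cast at h2
  linarith

end Cuts

/-! ### From parent trees to arcs, flows and codes -/

/-- The arc sets `F i` are pairwise disjoint and realize the trees `T i`. -/
structure Realizes (D : MulticastNetwork V A) {k : ℕ} (T : Fin k → ParentTree D.source)
    (F : Fin k → Set A) : Prop where
  disjoint : ∀ {i j e}, e ∈ F i → e ∈ F j → i = j
  uses : ∀ {i e}, e ∈ F i → (T i).Uses (D.tail e) (D.head e)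
  head_inj : ∀ {i e e'}, e ∈ F i → e' ∈ F i → D.head e = D.head e' → e = e'
  exists_arc : ∀ {i w}, w ∈ (T i).verts → w ≠ D.source → ∃ e ∈ F i, D.head e = w

/-- The load bound lets the trees using `u → w` be injected into the parallel arcs from `u` to `w`.
-/
theorem exists_realizes [Fintype A] {D : MulticastNetwork V A} {k : ℕ}
    {T : Fin k → ParentTree D.source} (hT : ∀ u w, ParentTree.load T u w ≤ D.capacity u w) :
    ∃ F, D.Realizes T F := by
  classical
  have hemb : ∀ u w, Nonempty
      ({i // (T i).Uses u w} ↪ {e // D.tail e = u ∧ D.head e = w}) := by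
    intro u w
    refine Function.Embedding.nonempty_of_card_le ?_
    rw [Fintype.card_subtype, Fintype.card_subtype]
    refine (hT u w).trans ?_
    unfold capacity
    split_ifs
    · exact Nat.zero_le _
    · exact le_rfl
  let g := fun u w => (hemb u w).some
  refine ⟨fun i => {e | ∃ h : (T i).Uses (D.tail e) (D.head e),
    (g (D.tail e) (D.head e) ⟨i, h⟩ : A) = e}, ?_, ?_, ?_, ?_⟩
  · rintro i j e ⟨h, he⟩ ⟨h', he'⟩
    have := (g _ _).injective (Subtype.ext (he.trans he'.symm))
    exact congrArg Subtype.val this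
  · rintro i e ⟨h, -⟩
    exact h
  · have key : ∀ {i u w} (h : (T i).Uses u w) {u' w'} (h' : (T i).Uses u' w'), w = w' →
        (g u w ⟨i, h⟩ : A) = g u' w' ⟨i, h'⟩ := by
      rintro i u w h u' w' h' rfl
      obtain rfl : u = u' := h.2.2.symm.trans h'.2.2
      rfl
    rintro i e e' ⟨h, he⟩ ⟨h', he'⟩ heq
    rw [← he, ← he']
    exact key h h' heq
  · intro i w hw hws
    have hu : (T i).Uses ((T i).parent w) w := ⟨hw, hws, rfl⟩
    obtain ⟨h1, h2⟩ := (g _ _ ⟨i, hu⟩).2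
    refine ⟨g _ _ ⟨i, hu⟩, ⟨by rw [h1, h2]; exact hu, ?_⟩, h2⟩
    have key : ∀ {u' w'} (h' : (T i).Uses u' w'), u' = (T i).parent w → w' = w →
        (g u' w' ⟨i, h'⟩ : A) = g _ _ ⟨i, hu⟩ := by
      rintro u' w' h' rfl rfl
      rfl
    exact key _ h1 h2

namespace Realizes

variable {D : MulticastNetwork V A} {k : ℕ} {T : Fin k → ParentTree D.source}
  {F : Fin k → Set A}

theorem reaches (h : D.Realizes T F) (i : Fin k) {w : V} (hw : w ∈ (T i).verts) :
    D.Reaches (F i) w := by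
  induction hn : (T i).rank w using Nat.strong_induction_on generalizing w with
  | _ n ih =>
    by_cases hws : w = D.source
    · subst hws
      exact Relation.ReflTransGen.refl
    · obtain ⟨e, he, rfl⟩ := h.exists_arc hw hws
      have hu := h.uses he
      exact (ih _ (hn ▸ hu.rank_lt) hu.mem rfl).tail ⟨e, he, rfl, rfl⟩

theorem hasTreePacking (h : D.Realizes T F)
    (hrec : ∀ i, ∀ t ∈ D.receivers, t ∈ (T i).verts) : D.HasTreePacking k :=
  ⟨F, fun _ _ hij => Set.disjoint_left.2 fun _ he he' => hij (h.disjoint he he'), fun i =>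
    ⟨⟨fun _ he => (h.uses he).2.1, fun _ he _ he' => h.head_inj he he',
      fun _ he => h.reaches i (h.uses he).mem⟩, fun t ht => h.reaches i (hrec i t ht)⟩⟩

section Flow

variable [Fintype A]

open scoped Classical in
-- Unit flow along the tree path to `x`, extended arc by arc. The rank condition on the support
-- ensures that the next arc is still unused.
theorem exists_pathFlow (h : D.Realizes T F) (i : Fin k) {x : V} (hx : x ∈ (T i).verts) :
    ∃ f : A → ℝ, (∀ e, 0 ≤ f e ∧ f e ≤ 1) ∧
      (∀ e, f e ≠ 0 → e ∈ F i ∧ (T i).rank (D.head e) ≤ (T i).rank x) ∧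
      ∀ v, D.netInflow f v = (if x = v then 1 else 0) - (if D.source = v then 1 else 0) := by
  induction hn : (T i).rank x using Nat.strong_induction_on generalizing x with
  | _ n ih =>
    subst hn
    by_cases hxs : x = D.source
    · subst hxs
      exact ⟨0, fun e => by simp, fun e he => absurd rfl he, fun v => by simp [netInflow]⟩
    · obtain ⟨e, he, rfl⟩ := h.exists_arc hx hxs
      have hu := h.uses he
      obtain ⟨f, hf1, hf2, hf3⟩ := ih _ hu.rank_lt hu.mem rfl
      have hfe : f e = 0 := by
        by_contra hne
        exact absurd (hf2 e hne).2 (not_le.2 hu.rank_lt)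
      refine ⟨f + Pi.single e 1, fun e' => ?_, fun e' he' => ?_, fun v => ?_⟩
      · by_cases hee : e' = e
        · subst hee
          simp [hfe]
        · simpa [hee] using hf1 e'
      · by_cases hee : e' = e
        · subst hee
          exact ⟨he, le_rfl⟩
        · have := hf2 e' (by simpa [hee] using he')
          exact ⟨this.1, this.2.trans hu.rank_lt.le⟩
      · have h3 := hf3 v
        rw [netInflow_eq_sum] at h3 ⊢
        simp only [Pi.add_apply, add_mul, Finset.sum_add_distrib, h3]
        rw [Finset.sum_eq_single e]
        · simp
        · intro e' _ hee
          simp [hee]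
        · simp

theorem le_maxFlow [Fintype V] (h : D.Realizes T F) {t : V} (hts : t ≠ D.source)
    (ht : ∀ i, t ∈ (T i).verts) : (k : ℝ) ≤ D.maxFlow t := by
  classical
  choose f hf1 hf2 hf3 using fun i => h.exists_pathFlow i (ht i)
  have hsum : ∀ v, D.netInflow (∑ i, f i) v = ∑ i, D.netInflow (f i) v := by
    intro v
    simp only [netInflow_eq_sum, Finset.sum_apply, Finset.sum_mul]
    exact Finset.sum_comm
  refine le_csSup (D.flowValues_bddAbove t) ⟨∑ i, f i, ⟨fun e => ?_, fun v hvs hvt => ?_⟩, ?_⟩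
  · rw [Finset.sum_apply]
    refine ⟨Finset.sum_nonneg fun i _ => (hf1 i e).1, ?_⟩
    by_cases hi : ∃ i, f i e ≠ 0
    · obtain ⟨i, hi⟩ := hi
      rw [Finset.sum_eq_single i]
      · exact (hf1 i e).2
      · intro j _ hji
        by_contra hj
        exact hji (h.disjoint (hf2 j e hj).1 (hf2 i e hi).1)
      · simp
    · push Not at hi
      simp [hi]
  · rw [hsum]
    simp [hf3, Ne.symm hvs, Ne.symm hvt]
  · rw [hsum]
    simp [hf3, Ne.symm hts]

end Flow

section Code

open scoped Classical in
/-- What an arc carries when a stream of symbols is sent along each tree: an arc of the `i`-th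
tree forwards the `i`-th stream, delayed by the rank of its head. -/
noncomputable def stream (T : Fin k → ParentTree D.source) (F : Fin k → Set A)
    (a : Fin k → ℕ → Fin 2) (e : A) (j : ℕ) : Fin 2 :=
  if h : ∃ i, e ∈ F i then
    if (T h.choose).rank (D.head e) ≤ j then a h.choose (j - (T h.choose).rank (D.head e)) else 0
  else 0

theorem stream_of_mem (h : D.Realizes T F) (a : Fin k → ℕ → Fin 2) {e : A} {i : Fin k}
    (he : e ∈ F i) (j : ℕ) : stream T F a e j =
      if (T i).rank (D.head e) ≤ j then a i (j - (T i).rank (D.head e)) else 0 := by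
  have hex : ∃ i, e ∈ F i := ⟨i, he⟩
  have : hex.choose = i := h.disjoint hex.choose_spec he
  unfold stream
  rw [dif_pos hex, this]

theorem stream_causal (h : D.Realizes T F) {a b : Fin k → ℕ → Fin 2} {e : A}
    (hs : D.tail e ≠ D.source) (j : ℕ)
    (hab : ∀ e', D.head e' = D.tail e → ∀ j' < j, stream T F a e' j' = stream T F b e' j') :
    stream T F a e j = stream T F b e j := by
  by_cases hex : ∃ i, e ∈ F i
  · obtain ⟨i, he⟩ := hex
    rw [h.stream_of_mem a he, h.stream_of_mem b he]
    split_ifs with hj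
    · have hu := h.uses he
      have hlt := hu.rank_lt
      obtain ⟨e', he', hhead⟩ := h.exists_arc hu.mem hs
      -- The slot in which the same stream symbol arrived at the tail; it is earlier than `j`
      -- because ranks increase along the tree.
      have := hab e' hhead (j - (T i).rank (D.head e) + (T i).rank (D.tail e)) (by omega)
      rw [h.stream_of_mem a he', h.stream_of_mem b he', hhead] at this
      simpa using this
    · rfl
  · unfold stream
    rw [dif_neg hex, dif_neg hex]

/-- Routing `N` symbols along every tree, given a bound `L` on the delays. -/
theorem nonempty_networkCode (h : D.Realizes T F)
    (hrec : ∀ i, ∀ t ∈ D.receivers, t ∈ (T i).verts) {L : ℕ}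
    (hL : ∀ i, ∀ t ∈ D.receivers, (T i).rank t ≤ L) (N : ℕ) :
    Nonempty (D.NetworkCode (2 ^ (N * k)) 2 (N + L)) := by
  classical
  have φ : Fin (2 ^ (N * k)) ≃ (Fin k → Fin N → Fin 2) :=
    (Fintype.equivFinOfCardEq (by simp [pow_mul])).symm
  -- Each tree carries a block of `N` bits padded with zeros. Bit `d` arrives in slot `d` plus the
  -- rank of the receiver, which is less than `N + L`.
  let val : Fin (2 ^ (N * k)) → Fin k → ℕ → Fin 2 :=
    fun x i d => if hd : d < N then φ x i ⟨d, hd⟩ else 0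
  refine ⟨fun x e j => stream T F (val x) e j, fun e he j x y hxy => ?_, fun t ht x y hxy => ?_⟩
  · refine h.stream_causal he j fun e' he' j' hj' => ?_
    exact hxy e' he' ⟨j', hj'.trans j.2⟩ hj'
  · refine φ.injective (funext fun i => funext fun d => ?_)
    obtain ⟨e, he, rfl⟩ := h.exists_arc (hrec i _ ht) (by rintro h; exact D.source_notMem (h ▸ ht))
    have hr := hL i _ ht
    have := hxy e rfl ⟨d + (T i).rank (D.head e), by omega⟩
    dsimp only at this
    rw [h.stream_of_mem _ he, h.stream_of_mem _ he] at this
    simpa [val] using this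

/-- Routing blocks of length `N` has rate `N k / (N + L)`, which tends to `k`. -/
theorem le_of_mem_upperBounds (h : D.Realizes T F)
    (hrec : ∀ i, ∀ t ∈ D.receivers, t ∈ (T i).verts) {b : ℝ}
    (hb : b ∈ upperBounds D.codingRates) : (k : ℝ) ≤ b := by
  obtain ⟨L, hL⟩ : ∃ L, ∀ i, ∀ t ∈ D.receivers, (T i).rank t ≤ L :=
    ⟨Finset.univ.sup fun i => D.receivers.sup (T i).rank, fun i t ht =>
      (Finset.le_sup (f := (T i).rank) ht).trans
        (Finset.le_sup (f := fun i => D.receivers.sup (T i).rank) (Finset.mem_univ i))⟩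
  have hlog : Real.log 2 ≠ 0 := (Real.log_pos one_lt_two).ne'
  have key : ∀ N : ℕ, 1 ≤ N → (N : ℝ) * k ≤ b * (N + L) := by
    intro N hN
    have hpos : (0 : ℝ) < N + L := by
      have : (1 : ℝ) ≤ N := by exact_mod_cast hN
      positivity
    have := hb ⟨2 ^ (N * k), 2, N + L, Nat.one_le_two_pow, le_rfl, by omega,
      h.nonempty_networkCode hrec hL N, rfl⟩
    rw [Nat.cast_pow, Real.log_pow, Nat.cast_ofNat, mul_div_mul_right _ _ hlog, Nat.cast_add,
      div_le_iff₀ hpos] at this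
    exact_mod_cast this
  by_contra! hlt
  obtain ⟨N, hN⟩ := exists_nat_gt (b * L / (k - b))
  rw [div_lt_iff₀ (sub_pos.2 hlt)] at hN
  have h1 := key (N + 1) (by omega)
  push_cast at h1
  nlinarith

end Code

end Realizes

end MulticastNetwork

/-! ### The main theorem -/

theorem mainTheorem1 {V A : Type*} [Fintype V] [Fintype A] (D : MulticastNetwork V A)
    (hK4 : ¬ D.topology.HasMinor (⊤ : SimpleGraph (Fin 4))) :
    ∃ h : ℕ, (h : ℝ) = D.minMaxFlow ∧
      D.HasTreePacking h ∧
      (∀ k, D.HasTreePacking k → k ≤ h) ∧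
      IsLUB D.codingRates (h : ℝ) := by
  classical
  obtain ⟨t₁, ht₁⟩ := D.receivers_nonempty
  obtain ⟨U, ⟨hsU, t₀, ht₀, ht₀U⟩, hmin⟩ := Set.exists_min_image
    {U : Set V | D.source ∉ U ∧ ∃ t ∈ D.receivers, t ∈ U} (fun U => (D.entering U).card)
    (Set.toFinite _)
    ⟨{t₁}, fun h => D.source_notMem (Set.mem_singleton_iff.1 h ▸ ht₁), t₁, ht₁, rfl⟩
  -- The number of trees is the minimum cut over all receivers, so the guarantee at each receiver is
  -- that all trees reach it.
  obtain ⟨T, hT, hcov⟩ := exists_treePacking D.topology hK4 D.capacity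
    (fun _ _ => MulticastNetwork.topology_adj_of_capacity_ne_zero) D.source (D.entering U).card
  have hrec : ∀ i, ∀ t ∈ D.receivers, t ∈ (T i).verts := by
    intro i t ht
    have h1 := hcov t t (Or.inl rfl) _ le_rfl fun U' hs htU' _ => by
      rw [D.cutCap_capacity]
      exact hmin U' ⟨hs, t, ht, htU'⟩
    rw [Finset.union_self] at h1
    have h2 : ParentTree.cover T t = Finset.univ :=
      Finset.eq_univ_of_card _ (le_antisymm (Finset.card_le_univ _) (by simpa using h1))
    exact ParentTree.mem_cover.1 (h2 ▸ Finset.mem_univ i)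
  obtain ⟨F, hF⟩ := MulticastNetwork.exists_realizes hT
  refine ⟨(D.entering U).card, le_antisymm ?_ ?_, hF.hasTreePacking hrec,
    fun k hk => hk.le_card_entering ht₀ hsU ht₀U,
    fun r hr => MulticastNetwork.codingRates_le ht₀ hsU ht₀U hr,
    fun b hb => hF.le_of_mem_upperBounds hrec hb⟩
  · exact Finset.le_inf' _ _ fun t ht =>
      hF.le_maxFlow (by rintro rfl; exact D.source_notMem ht) fun i => hrec i t ht
  · refine (Finset.inf'_le _ ht₀).trans (csSup_le (D.flowValues_nonempty t₀) ?_)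
    rintro r ⟨f, hf, rfl⟩
    exact hf.netInflow_le hsU ht₀U
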